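/- **Setting.** An *event graph* consists of a set of events with attributes and binary relations, considered up to isomorphism. An *operation context* is a finite event graph $C=(E,\mathsf{op},\mathsf{vis},\mathsf{ar})$ in which every event is labelled by an operation, $\mathsf{vis}$ (visibility) is acyclic and $\mathsf{ar}$ (arbitration) is a strict total order. A *replicated data type* $\mathcal F$ assigns to every operation and every operation context a return value, the same for isomorphic contexts. An operation is *read-only* if deleting an event with this operation from an operation context never changes the result of any operation. An *ACT specification* is a pair $(\mathcal F,\mathsf{lvlmap})$, where $\mathsf{lvlmap}$ assigns to every operation the set of consistency levels (in $\{\mathsf{weak},\mathsf{strong}\}$) with which clients may invoke it. A *history* $H=(E,\mathsf{op},\mathsf{rval},\mathsf{rb},\mathsf{ss},\mathsf{lvl})$ records the invoked operations, their return values ($\nabla$ if the operation is pending, i.e. never returns), the returns-before relation, the same-session relation and the levels. An *abstract execution* extends $H$ by an acyclic relation $\mathsf{vis}$ in which every event has finitely many predecessors, a strict total order $\mathsf{ar}$, and strict total orders $\mathsf{par}(e)$, $e\in E$. For a level $l$ put $L=\{e\in E:\mathsf{lvl}(e)=l\}$, $\mathsf{so}=\mathsf{rb}\cap\mathsf{ss}$,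 $\mathsf{hb}=(\mathsf{so}\cup\mathsf{vis})^+$, $\mathsf{rank}(S,\mathsf{rel},e)=|\{x\in S: x\xrightarrow{\mathsf{rel}}e\}|$ and - $\mathrm{EV}(l)$: for each $e\in E$ only finitely many $e'\in L$ satisfy $e\xrightarrow{\mathsf{rb}}e'$ and not $e\xrightarrow{\mathsf{vis}}e'$; - $\mathrm{NCC}(l)$: $\mathsf{hb}\cap(L\times L)$ is acyclic; - $\mathrm{RVal}(l,\mathcal F)$: $\mathsf{rval}(e)=\mathcal F(\mathsf{op}(e),(\mathsf{vis}^{-1}(e),\mathsf{op},\mathsf{vis},\mathsf{ar}))$ for all $e\in L$; - $\mathrm{FRVal}(l,\mathcal F)$: $\mathsf{rval}(e)=\mathcal F(\mathsf{op}(e),(\mathsf{vis}^{-1}(e),\mathsf{op},\mathsf{vis},\mathsf{par}(e)))$ for all $e\in L$; - $\mathrm{CPar}(l)$: for each $e\in E$ only finitely many $e'\in L$ satisfy $e\xrightarrow{\mathsf{vis}}e'$ and $\mathsf{rank}(\mathsf{vis}^{-1}(e'),\mathsf{par}(e'),e)\ne\mathsf{rank}(\mathsf{vis}^{-1}(e'),\mathsf{ar},e)$;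 - $\mathrm{SinOrd}(l)$: $\mathsf{vis}\cap(E\times L)=(\mathsf{ar}\cap(E\times L))\setminus(E'\times E)$ for some set $E'$ of pending events; - $\mathrm{RT}(l)$: $\mathsf{rb}\cap(L\times L)\subseteq\mathsf{ar}$. Further $\mathrm{FEC}(l,\mathcal F)=\mathrm{EV}(l)\wedge\mathrm{NCC}(l)\wedge\mathrm{FRVal}(l,\mathcal F)\wedge\mathrm{CPar}(l)$ and $\mathrm{Lin}(l,\mathcal F)=\mathrm{SinOrd}(l)\wedge\mathrm{RT}(l)\wedge\mathrm{EV}(l)\wedge\mathrm{NCC}(l)\wedge\mathrm{RVal}(l,\mathcal F)$. A history satisfies such a guarantee if some abstract execution extending it does; a protocol satisfies it in a class of runs if the histories of all these runs do. **AcuteBayou** is the following protocol, run by finitely many replicas communicating by reliable broadcast (RB) and total order broadcast (TOB). A request record contains a timestamp (local clock), a unique dot (replica identifier, local sequence number), the set of dots of the requests that are currently in the trace of the issuing replica's state object, the level, and the operation. Each replica keeps a list $\mathsf{committed}$, a list $\mathsf{tentative}$ sorted by (timestamp, dot), lists $\mathsf{executed}$, $\mathsf{toBeExecuted}$, $\mathsf{toBeRolledBack}$,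 and a state object; the latter answers an operation by applying $\mathcal F$ to the context formed by its trace (the requests executed and not rolled back), ordered by position in the trace, where a request is visible to a weak one if its dot is recorded in the latter and to a strong one if it precedes it. A weak read-only operation is answered at once from the state object. Any other weak operation is executed at once on the state object, rolled back, RB-cast and TOB-cast, inserted into $\mathsf{tentative}$, and its response is returned at once. A strong operation is only TOB-cast. On RB-delivery of a request issued elsewhere and not yet committed, it is inserted into $\mathsf{tentative}$; on TOB-delivery a request is appended to $\mathsf{committed}$ and removed from $\mathsf{tentative}$. After each such change of $\mathsf{committed}\cdot\mathsf{tentative}$, executed requests beyond the longest common prefix of $\mathsf{executed}$ and this new order are scheduled for rollback and the remaining requests of the new order for execution; internal steps perform the rollbacks and then the executions one by one. The response to a strong operation is returned by its issuing replica when the request is executed there after being committed. An *asynchronous run* is an infinite well-formed execution (local clocks are integer valued, monotone, and take infinitely many values at each replica taking infinitely many steps; each client uses a single replica, issues operations sequentially and respects $\mathsf{lvlmap}$) which is fair (every replica takes infinitely many steps, and each kind of internal step at each replica occurs infinitely often or is infinitely often disabled after a step of this replica) and in which: delivered messages were sent before, and are delivered at most once per replica; every RB-cast message is delivered by all replicas;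 a message TOB-delivered by one replica is TOB-delivered by all; all replicas TOB-deliver in the same total order; and if infinitely many messages are TOB-delivered, then every TOB-cast message is TOB-delivered. Apart from this, TOB-cast messages may remain undelivered forever. **Theorem 4.** Let $(\mathcal F,\mathsf{lvlmap})$ be an arbitrary ACT specification and consider AcuteBayou with any number $n\ge 1$ of replicas. The history of every asynchronous run of AcuteBayou satisfies $\mathrm{FEC}(\mathsf{weak},\mathcal F)$. If $\mathsf{lvlmap}$ allows at least one operation to be invoked as strong, then AcuteBayou does not satisfy $\mathrm{Lin}(\mathsf{strong},\mathcal F)$ in asynchronous runs: there is an asynchronous run, with infinitely many invocations at every replica, in which some strong operation remains pending and whose history does not satisfy $\mathrm{Lin}(\mathsf{strong},\mathcal F)$. -/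

import Mathlib

namespace ACT

universe u v

/-! ## Relations -/

/-- No cycle `x → ... → x`. -/
def Acyclic {A : Type*} (rel : A → A → Prop) : Prop :=
  ∀ x, ¬ Relation.TransGen rel x x

/-- Every element has only finitely many predecessors. -/
def Natural {A : Type*} (rel : A → A → Prop) : Prop :=
  ∀ x, {y | rel y x}.Finite

/-- Irreflexive and transitive. -/
def PartialOrderRel {A : Type*} (rel : A → A → Prop) : Prop :=
  (∀ x, ¬ rel x x) ∧ ∀ x y z, rel x y → rel y z → rel x z

/-- Irreflexive, transitive and total. -/
def TotalOrderRel {A : Type*} (rel : A → A → Prop) : Prop :=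
  PartialOrderRel rel ∧ ∀ x y, x ≠ y → rel x y ∨ rel y x

/-- A total order in which every element has finitely many predecessors. -/
def Enumeration {A : Type*} (rel : A → A → Prop) : Prop :=
  TotalOrderRel rel ∧ Natural rel

/-- The number of elements of `S` that are in relation `rel` to `a`. -/
noncomputable def rank {A : Type*} (S : Set A) (rel : A → A → Prop) (a : A) : ℕ :=
  {x | x ∈ S ∧ rel x a}.ncard

/-! ## Replicated data types and ACT specifications -/

/-- Consistency level of an operation invocation. -/
inductive Level : Type
  | weak : Level
  | strong : Level

/-- An event graph `(E, op, vis, ar)`. -/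
structure Context (Op : Type u) : Type (max 1 u) where
  E : Type
  op : E → Op
  vis : E → E → Prop
  ar : E → E → Prop

namespace Context

variable {Op : Type u}

/-- The event graphs that arise as operation contexts in abstract executions. -/
def IsOperationContext (C : Context Op) : Prop :=
  Finite C.E ∧ Acyclic C.vis ∧ TotalOrderRel C.ar

/-- Isomorphism of event graphs. -/
def Iso (C D : Context Op) : Prop :=
  ∃ φ : C.E ≃ D.E, (∀ x, C.op x = D.op (φ x)) ∧
    (∀ x y, C.vis x y ↔ D.vis (φ x) (φ y)) ∧ (∀ x y, C.ar x y ↔ D.ar (φ x) (φ y))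

/-- The event graph with the event `e` removed. -/
def remove (C : Context Op) (e : C.E) : Context Op where
  E := {x : C.E // x ≠ e}
  op x := C.op x
  vis x y := C.vis x y
  ar x y := C.ar x y

end Context

/-- A replicated data type: for every operation and every operation context the expected return
value, the same for isomorphic contexts. The values of `F` on event graphs that are not operation
contexts are unconstrained and play no role. -/
structure DataType (Op : Type u) (Val : Type v) where
  F : Op → Context Op → Val
  iso_invariant : ∀ (op : Op) (C D : Context Op), C.IsOperationContext → C.Iso D → F op C = F op D

/-- `op` is read-only: removing an event with this operation from a context never changes the
result of any operation. -/
def DataType.ReadOnly {Op : Type u} {Val : Type v} (D : DataType Op Val) (op : Op) : Prop :=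
  ∀ (q : Op) (C : Context Op), C.IsOperationContext → ∀ e : C.E, C.op e = op →
    D.F q C = D.F q (C.remove e)

/-- An ACT specification `(F, lvlmap)`. -/
structure Spec (Op : Type u) (Val : Type v) where
  dataType : DataType Op Val
  lvlmap : Op → Set Level

/-! ## Histories and abstract executions -/

/-- Well-formed histories. `rval e = none` means that the operation of `e` never returns, i.e.
that `e` is pending. -/
structure History (Op : Type u) (Val : Type v) where
  E : Type
  op : E → Op
  rval : E → Option Val
  /-- returns-before -/
  rb : E → E → Prop
  /-- same session -/
  ss : E → E → Prop
  lvl : E → Level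
  countable_events : Countable E
  rb_partialOrder : PartialOrderRel rb
  rb_natural : Natural rb
  ss_equivalence : Equivalence ss
  not_pending_of_rb : ∀ a b, rb a b → rval a ≠ none
  rb_interval : ∀ a b c d, rb a b → rb c d → rb a d ∨ rb c b
  session_enumeration : ∀ e, Enumeration (fun a b : {x : E // ss e x} => rb a b)

/-- An abstract execution extending the history `H`: visibility, arbitration and the arbitration
perceived by each event. -/
structure AbstractExecution {Op : Type u} {Val : Type v} (H : History Op Val) where
  vis : H.E → H.E → Prop
  ar : H.E → H.E → Prop
  par : H.E → H.E → H.E → Prop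
  vis_acyclic : Acyclic vis
  vis_natural : Natural vis
  ar_total : TotalOrderRel ar
  par_total : ∀ e, TotalOrderRel (par e)

namespace AbstractExecution

variable {Op : Type u} {Val : Type v} {H : History Op Val}

/-- The operation context of `e`. -/
def context (A : AbstractExecution H) (e : H.E) : Context Op where
  E := {x : H.E // A.vis x e}
  op x := H.op x
  vis x y := A.vis x y
  ar x y := A.ar x y

/-- The operation context of `e`, ordered as perceived by `e`. -/
def fcontext (A : AbstractExecution H) (e : H.E) : Context Op where
  E := {x : H.E // A.vis x e}
  op x := H.op x
  vis x y := A.vis x y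
  ar x y := A.par e x y

/-- Happens-before: transitive closure of session order and visibility. -/
def hb (A : AbstractExecution H) : H.E → H.E → Prop :=
  Relation.TransGen (fun a b => (H.rb a b ∧ H.ss a b) ∨ A.vis a b)

/-- Eventual visibility. -/
def EV (A : AbstractExecution H) (l : Level) : Prop :=
  ∀ e, {e' | H.lvl e' = l ∧ H.rb e e' ∧ ¬ A.vis e e'}.Finite

/-- No circular causality. -/
def NCC (A : AbstractExecution H) (l : Level) : Prop :=
  Acyclic (fun a b => A.hb a b ∧ H.lvl a = l ∧ H.lvl b = l)

/-- Return value consistency. -/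
def RVal (A : AbstractExecution H) (l : Level) (D : DataType Op Val) : Prop :=
  ∀ e, H.lvl e = l → H.rval e = some (D.F (H.op e) (A.context e))

/-- Fluctuating return value consistency. -/
def FRVal (A : AbstractExecution H) (l : Level) (D : DataType Op Val) : Prop :=
  ∀ e, H.lvl e = l → H.rval e = some (D.F (H.op e) (A.fcontext e))

/-- Convergent perceived arbitration. -/
def CPar (A : AbstractExecution H) (l : Level) : Prop :=
  ∀ e, {e' | H.lvl e' = l ∧ A.vis e e' ∧
    rank {x | A.vis x e'} (A.par e') e ≠ rank {x | A.vis x e'} A.ar e}.Finite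

/-- Single order. -/
def SinOrd (A : AbstractExecution H) (l : Level) : Prop :=
  ∃ P : Set H.E, (∀ e ∈ P, H.rval e = none) ∧
    ∀ a b, (A.vis a b ∧ H.lvl b = l) ↔ ((A.ar a b ∧ H.lvl b = l) ∧ a ∉ P)

/-- Real-time order. -/
def RT (A : AbstractExecution H) (l : Level) : Prop :=
  ∀ a b, H.rb a b → H.lvl a = l → H.lvl b = l → A.ar a b

/-- Basic eventual consistency. -/
def BEC (A : AbstractExecution H) (l : Level) (D : DataType Op Val) : Prop :=
  A.EV l ∧ A.NCC l ∧ A.RVal l D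

/-- Fluctuating eventual consistency. -/
def FEC (A : AbstractExecution H) (l : Level) (D : DataType Op Val) : Prop :=
  A.EV l ∧ A.NCC l ∧ A.FRVal l D ∧ A.CPar l

/-- Linearizability. -/
def Lin (A : AbstractExecution H) (l : Level) (D : DataType Op Val) : Prop :=
  A.SinOrd l ∧ A.RT l ∧ A.BEC l D

end AbstractExecution

/-- The history can be extended to an abstract execution satisfying `FEC`. -/
def History.SatisfiesFEC {Op : Type u} {Val : Type v} (H : History Op Val) (l : Level)
    (D : DataType Op Val) : Prop :=
  ∃ A : AbstractExecution H, A.FEC l D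

/-- The history can be extended to an abstract execution satisfying `Lin`. -/
def History.SatisfiesLin {Op : Type u} {Val : Type v} (H : History Op Val) (l : Level)
    (D : DataType Op Val) : Prop :=
  ∃ A : AbstractExecution H, A.Lin l D

/-! ## The AcuteBayou protocol with replicas `Fin n` -/

/-- Request records. -/
structure Req (n : ℕ) (Op : Type u) where
  timestamp : ℤ
  dot : Fin n × ℕ
  ctx : Finset (Fin n × ℕ)
  lvl : Level
  op : Op

/-- Lexicographic comparison of `(timestamp, dot)`. -/
def Req.Before {n : ℕ} {Op : Type u} (r s : Req n Op) : Prop :=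
  r.timestamp < s.timestamp ∨ (r.timestamp = s.timestamp ∧
    (r.dot.1 < s.dot.1 ∨ (r.dot.1 = s.dot.1 ∧ r.dot.2 < s.dot.2)))

/-- The context `C_α` determined by the trace `α` of the state object. An event is a request of the
trace, given by its position; a request is visible to a weak one if its dot is in the `ctx` field
of the latter, and to a strong one if it precedes it in the trace. -/
def traceContext {n : ℕ} {Op : Type u} (α : List (Req n Op)) : Context Op where
  E := Fin α.length
  op i := (α.get i).op
  vis i j :=
    match (α.get j).lvl with
    | Level.weak => (α.get i).dot ∈ (α.get j).ctx
    | Level.strong => i < j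
  ar i j := i < j

/-- The state object, represented by its current trace: the requests executed on it and not rolled
back, in order of execution. -/
abbrev StateObject (n : ℕ) (Op : Type u) := List (Req n Op)

namespace StateObject

variable {n : ℕ} {Op : Type u} {Val : Type v}

/-- Response of the state object to an operation executed on it. -/
def respond (D : DataType Op Val) (α : StateObject n Op) (op : Op) : Val :=
  D.F op (traceContext α)

/-- Executing a request: the response and the new state. -/
def execute (D : DataType Op Val) (α : StateObject n Op) (r : Req n Op) : Val × StateObject n Op :=
  (respond D α r.op, α ++ [r])

open Classical in
/-- Rolling back a request. -/
noncomputable def rollback (α : StateObject n Op) (r : Req n Op) : StateObject n Op :=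
  α.filter (fun x => x ≠ r)

end StateObject

open Classical in
/-- Longest common prefix of two lists. -/
noncomputable def longestCommonPrefix {A : Type*} : List A → List A → List A
  | a :: l, b :: m => if a = b then a :: longestCommonPrefix l m else []
  | _, _ => []

/-- Local state of a replica. In the map `reqsAwaitingResp`, `none` means that the key is absent
and `some none` that it is mapped to `⊥`. -/
structure RState (n : ℕ) (Op : Type u) (Val : Type v) where
  state : StateObject n Op
  currEventNo : ℕ
  committed : List (Req n Op)
  tentative : List (Req n Op)
  executed : List (Req n Op)
  toBeExecuted : List (Req n Op)
  toBeRolledBack : List (Req n Op)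
  reqsAwaitingResp : Req n Op → Option (Option Val)

/-- The initial state. -/
def RState.initial (n : ℕ) (Op : Type u) (Val : Type v) : RState n Op Val where
  state := []
  currEventNo := 0
  committed := []
  tentative := []
  executed := []
  toBeExecuted := []
  toBeRolledBack := []
  reqsAwaitingResp := fun _ => none

/-- Events of a replica: invocation of an operation by a client (clients are identified by natural
numbers), delivery of a message by reliable broadcast or by total order broadcast, and the two
internal steps. -/
inductive Action (n : ℕ) (Op : Type u) : Type u
  | invoke (client : ℕ) (op : Op) (lvl : Level) : Action n Op
  | rbDeliver (r : Req n Op) : Action n Op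
  | tobDeliver (r : Req n Op) : Action n Op
  | rollback : Action n Op
  | execute : Action n Op

/-- The client, operation and level of an invocation. -/
def Action.invocation {n : ℕ} {Op : Type u} : Action n Op → Option (ℕ × Op × Level)
  | Action.invoke c op l => some (c, op, l)
  | _ => none

/-- What a replica emits during an event: the messages it broadcasts, the response returned at once
to the client whose operation is invoked in this event, and the response returned to the client
that is waiting for the outcome of a request. -/
structure Output (n : ℕ) (Op : Type u) (Val : Type v) where
  rbcast : Option (Req n Op)
  tobcast : Option (Req n Op)
  returned : Option Val
  answered : Option (Req n Op × Val)

/-- Nothing is emitted. -/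
def Output.silent (n : ℕ) (Op : Type u) (Val : Type v) : Output n Op Val where
  rbcast := none
  tobcast := none
  returned := none
  answered := none

section Protocol

variable {n : ℕ} {Op : Type u} {Val : Type v}

open Classical in
/-- Procedure `adjustExecution`. -/
noncomputable def adjustExecution (σ : RState n Op Val) (newOrder : List (Req n Op)) :
    RState n Op Val :=
  let inOrder := longestCommonPrefix σ.executed newOrder
  let outOfOrder := σ.executed.filter (fun x => x ∉ inOrder)
  { σ with
    executed := inOrder
    toBeExecuted := newOrder.filter (fun x => x ∉ inOrder)
    toBeRolledBack := σ.toBeRolledBack ++ outOfOrder.reverse }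

open Classical in
/-- Procedure `insertIntoTentative`. -/
noncomputable def insertIntoTentative (σ : RState n Op Val) (r : Req n Op) : RState n Op Val :=
  let previous := σ.tentative.filter (fun x => x.Before r)
  let subsequent := σ.tentative.filter (fun x => r.Before x)
  let newTentative := previous ++ [r] ++ subsequent
  adjustExecution { σ with tentative := newTentative } (σ.committed ++ newTentative)

open Classical in
/-- Procedure `commit`. -/
noncomputable def commit (σ : RState n Op Val) (r : Req n Op) : RState n Op Val × Output n Op Val :=
  let newCommitted := σ.committed ++ [r]
  let newTentative := σ.tentative.filter (fun x => x ≠ r)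
  let τ := adjustExecution { σ with committed := newCommitted, tentative := newTentative }
    (newCommitted ++ newTentative)
  if (τ.reqsAwaitingResp r).isSome ∧ r ∈ τ.executed then
    ({ τ with reqsAwaitingResp := Function.update τ.reqsAwaitingResp r none },
      { Output.silent n Op Val with
        answered := (τ.reqsAwaitingResp r).join.map (fun v => (r, v)) })
  else
    (τ, Output.silent n Op Val)

open Classical in
/-- Invocation of an operation at replica `i`, at local time `clock`. -/
noncomputable def invokeStep (D : DataType Op Val) (i : Fin n) (clock : ℤ) (op : Op) (lvl : Level)
    (σ : RState n Op Val) : RState n Op Val × Output n Op Val :=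
  if lvl = Level.weak ∧ D.ReadOnly op then
    (σ, { Output.silent n Op Val with returned := some (StateObject.respond D σ.state op) })
  else
    let eventNo := σ.currEventNo + 1
    let r : Req n Op :=
      { timestamp := clock
        dot := (i, eventNo)
        ctx := (σ.executed.map Req.dot).toFinset ∪ (σ.toBeRolledBack.map Req.dot).toFinset
        lvl := lvl
        op := op }
    match lvl with
    | Level.weak =>
      let res := StateObject.execute D σ.state r
      (insertIntoTentative
        { σ with currEventNo := eventNo, state := StateObject.rollback res.2 r } r,
        { Output.silent n Op Val with
          rbcast := some r
          tobcast := some r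
          returned := some res.1 })
    | Level.strong =>
      ({ σ with
          currEventNo := eventNo
          reqsAwaitingResp := Function.update σ.reqsAwaitingResp r (some none) },
        { Output.silent n Op Val with tobcast := some r })

open Classical in
/-- Delivery of the request `r` by reliable broadcast at replica `i`. -/
noncomputable def rbDeliverStep (i : Fin n) (r : Req n Op) (σ : RState n Op Val) : RState n Op Val :=
  if r.dot.1 = i then σ
  else if r ∉ σ.committed then insertIntoTentative σ r
  else σ

/-- Rolling back one request; enabled if `toBeRolledBack` is not empty. -/
noncomputable def rollbackStep (σ : RState n Op Val) : Option (RState n Op Val) :=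
  match σ.toBeRolledBack with
  | [] => none
  | head :: tail =>
    some { σ with state := StateObject.rollback σ.state head, toBeRolledBack := tail }

open Classical in
/-- Executing one request; enabled if `toBeRolledBack` is empty and `toBeExecuted` is not. -/
noncomputable def executeStep (D : DataType Op Val) (σ : RState n Op Val) :
    Option (RState n Op Val × Output n Op Val) :=
  match σ.toBeRolledBack, σ.toBeExecuted with
  | [], head :: tail =>
    let res := StateObject.execute D σ.state head
    let τ : RState n Op Val :=
      { σ with state := res.2, executed := σ.executed ++ [head], toBeExecuted := tail }
    if (σ.reqsAwaitingResp head).isSome then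
      if head.lvl = Level.weak ∨ head ∈ σ.committed then
        some ({ τ with reqsAwaitingResp := Function.update σ.reqsAwaitingResp head none },
          { Output.silent n Op Val with answered := some (head, res.1) })
      else
        some ({ τ with
            reqsAwaitingResp := Function.update σ.reqsAwaitingResp head (some (some res.1)) },
          Output.silent n Op Val)
    else
      some (τ, Output.silent n Op Val)
  | _, _ => none

/-- The partial transition function of replica `i`, together with the output of the step. -/
noncomputable def step (D : DataType Op Val) (i : Fin n) (clock : ℤ) (σ : RState n Op Val) :
    Action n Op → Option (RState n Op Val × Output n Op Val)
  | Action.invoke _ op lvl => some (invokeStep D i clock op lvl σ)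
  | Action.rbDeliver r => some (rbDeliverStep i r σ, Output.silent n Op Val)
  | Action.tobDeliver r => some (commit σ r)
  | Action.rollback => (rollbackStep σ).map (fun τ => (τ, Output.silent n Op Val))
  | Action.execute => executeStep D σ

end Protocol

/-! ## Executions of AcuteBayou -/

/-- An event occurring in an execution. -/
structure Event (n : ℕ) (Op : Type u) where
  rep : Fin n
  clock : ℤ
  act : Action n Op

/-- An infinite sequence of events of `n` replicas running AcuteBayou. `config k R` is the state of
replica `R` just before the `k`-th event and `out k` is the output of the `k`-th event. -/
structure Trajectory (n : ℕ) {Op : Type u} {Val : Type v} (S : Spec Op Val) where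
  event : ℕ → Event n Op
  config : ℕ → Fin n → RState n Op Val
  out : ℕ → Output n Op Val
  config_zero : ∀ R, config 0 R = RState.initial n Op Val
  config_step : ∀ k, step S.dataType (event k).rep (event k).clock (config k (event k).rep)
    (event k).act = some (config (k + 1) (event k).rep, out k)
  config_other : ∀ k R, R ≠ (event k).rep → config (k + 1) R = config k R

namespace Trajectory

variable {n : ℕ} {Op : Type u} {Val : Type v} {S : Spec Op Val}

open Classical in
/-- The response which the event `j` returns to the operation invoked in the event `k`, if any. -/
noncomputable def respAt (G : Trajectory n S) (k j : ℕ) : Option Val :=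
  if j = k then (G.out k).returned
  else if k < j then
    match (G.out k).tobcast, (G.out j).answered with
    | some r, some (s, v) => if r = s then some v else none
    | _, _ => none
  else none

/-- The operation invoked in the event `k` receives its response before the event `m`. -/
def ReturnsBefore (G : Trajectory n S) (k m : ℕ) : Prop :=
  ∃ j, j < m ∧ (G.respAt k j).isSome

open Classical in
/-- The (first) response to the operation invoked in the event `k`; `none` if it is pending. -/
noncomputable def response (G : Trajectory n S) (k : ℕ) : Option Val :=
  if h : ∃ j, (G.respAt k j).isSome then G.respAt k (Nat.find h) else none

/-- The event `k` is an event of replica `R` with the given action. -/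
def Occurs (G : Trajectory n S) (k : ℕ) (R : Fin n) (a : Action n Op) : Prop :=
  (G.event k).rep = R ∧ (G.event k).act = a

theorem le_of_respAt (G : Trajectory n S) {k j : ℕ} (h : (G.respAt k j).isSome) : k ≤ j := by
  unfold respAt at h
  split_ifs at h with h1 h2
  · exact h1.ge
  · exact h2.le
  · simp at h

theorem response_ne_none (G : Trajectory n S) {k j : ℕ} (h : (G.respAt k j).isSome) :
    G.response k ≠ none := by
  classical
  have hex : ∃ j, (G.respAt k j).isSome := ⟨j, h⟩
  have hs := Nat.find_spec hex
  unfold response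
  rw [dif_pos hex]
  exact Option.isSome_iff_ne_none.mp hs

end Trajectory

/-- Well-formed executions of AcuteBayou for the specification `S`: local clocks are monotone and
do not stall, clients are sticky and sequential, and they follow the level contract of `S`. -/
structure Execution (n : ℕ) {Op : Type u} {Val : Type v} (S : Spec Op Val)
    extends Trajectory n S where
  clock_mono : ∀ j k, j < k → (event j).rep = (event k).rep → (event j).clock ≤ (event k).clock
  clock_infinite : ∀ R, {k | (event k).rep = R}.Infinite →
    {t | ∃ k, (event k).rep = R ∧ (event k).clock = t}.Infinite
  sticky : ∀ j k c op op' l l', (event j).act = Action.invoke c op l →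
    (event k).act = Action.invoke c op' l' → (event j).rep = (event k).rep
  sequential : ∀ j k c op op' l l', j < k → (event j).act = Action.invoke c op l →
    (event k).act = Action.invoke c op' l' → toTrajectory.ReturnsBefore j k
  contract : ∀ k c op l, (event k).act = Action.invoke c op l → l ∈ S.lvlmap op

namespace Execution

variable {n : ℕ} {Op : Type u} {Val : Type v} {S : Spec Op Val}

/-- The events of the history: the positions of invocations. -/
abbrev Inv (G : Execution n S) : Type :=
  {k : ℕ // ((G.event k).act.invocation).isSome}

/-- Client, operation and level of an invocation. -/
def invData (G : Execution n S) (e : G.Inv) : ℕ × Op × Level :=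
  ((G.event e).act.invocation).get e.2

theorem act_eq (G : Execution n S) (e : G.Inv) :
    (G.event e).act = Action.invoke (G.invData e).1 (G.invData e).2.1 (G.invData e).2.2 := by
  have key : ∀ (a : Action n Op) (h : a.invocation.isSome),
      a = Action.invoke (a.invocation.get h).1 (a.invocation.get h).2.1 (a.invocation.get h).2.2 := by
    intro a h
    cases a with
    | invoke c op l => rfl
    | _ => exact absurd h Bool.false_ne_true
  exact key _ e.2

theorem returnsBefore_of_lt (G : Execution n S) {a b : G.Inv}
    (hc : (G.invData a).1 = (G.invData b).1) (hab : (a : ℕ) < b) : G.ReturnsBefore a b :=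
  G.sequential a b (G.invData a).1 _ _ _ _ hab (G.act_eq a) (by rw [hc]; exact G.act_eq b)

/-- The history of an execution. -/
noncomputable def history (G : Execution n S) : History Op Val where
  E := G.Inv
  op e := (G.invData e).2.1
  rval e := G.response e
  rb a b := G.ReturnsBefore a b
  ss a b := (G.invData a).1 = (G.invData b).1
  lvl e := (G.invData e).2.2
  countable_events := inferInstance
  rb_partialOrder := by
    refine ⟨?_, ?_⟩
    · rintro x ⟨j, hj, h⟩
      exact absurd (G.le_of_respAt h) (by omega)
    · rintro x y z ⟨j, hj, h⟩ ⟨j', hj', h'⟩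
      exact ⟨j, by have := G.le_of_respAt h'; omega, h⟩
  rb_natural := by
    intro x
    refine Set.Finite.of_finite_image (f := Subtype.val) ?_ Subtype.val_injective.injOn
    refine (Set.finite_Iio (x : ℕ)).subset ?_
    rintro _ ⟨y, ⟨j, hj, h⟩, rfl⟩
    have := G.le_of_respAt h
    exact Set.mem_Iio.mpr (by omega)
  ss_equivalence := ⟨fun _ => rfl, fun h => h.symm, fun h h' => h.trans h'⟩
  not_pending_of_rb := by
    rintro a b ⟨j, _, h⟩
    exact G.response_ne_none h
  rb_interval := by
    rintro a b c d ⟨j, hj, h⟩ ⟨j', hj', h'⟩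
    by_cases hd : j < d
    · exact Or.inl ⟨j, hd, h⟩
    · exact Or.inr ⟨j', by omega, h'⟩
  session_enumeration := by
    intro e
    refine ⟨⟨⟨?_, ?_⟩, ?_⟩, ?_⟩
    · rintro x ⟨j, hj, h⟩
      exact absurd (G.le_of_respAt h) (by omega)
    · rintro x y z ⟨j, hj, h⟩ ⟨j', hj', h'⟩
      exact ⟨j, by have := G.le_of_respAt h'; omega, h⟩
    · rintro ⟨x, hx⟩ ⟨y, hy⟩ hxy
      have hne : (x : ℕ) ≠ y := fun h => hxy (Subtype.ext (Subtype.ext h))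
      rcases Nat.lt_or_gt_of_ne hne with h | h
      · exact Or.inl (G.returnsBefore_of_lt (hx.symm.trans hy) h)
      · exact Or.inr (G.returnsBefore_of_lt (hy.symm.trans hx) h)
    · rintro ⟨x, hx⟩
      refine Set.Finite.of_finite_image (f := fun y => (y.1 : ℕ)) ?_
        (fun a _ b _ h => Subtype.ext (Subtype.ext h))
      refine (Set.finite_Iio (x : ℕ)).subset ?_
      rintro _ ⟨y, ⟨j, hj, h⟩, rfl⟩
      exact Set.mem_Iio.mpr (lt_of_le_of_lt (G.le_of_respAt h) hj)

/-- The internal action `a` is enabled in the state `σ` of replica `R`. -/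
def Enabled (S : Spec Op Val) (R : Fin n) (σ : RState n Op Val) (a : Action n Op) : Prop :=
  ∃ clock, (step S.dataType R clock σ a).isSome

/-- The action `a` is treated fairly at `R`: it occurs infinitely often, or it is infinitely often
disabled right after an event of `R`. -/
def FairFor (G : Execution n S) (R : Fin n) (a : Action n Op) : Prop :=
  {k | G.Occurs k R a}.Infinite ∨
    {k | (G.event k).rep = R ∧ ¬ Enabled S R (G.config (k + 1) R) a}.Infinite

/-- Every replica executes infinitely many events (so every replica is correct), and both kinds of
internal events are treated fairly. Fairness of message deliveries is part of the guarantees of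
the network. -/
def Fair (G : Execution n S) : Prop :=
  ∀ R, {k | (G.event k).rep = R}.Infinite ∧ G.FairFor R Action.rollback ∧
    G.FairFor R Action.execute

/-- The message `r` is delivered by total order broadcast at some replica. -/
def TobDelivered (G : Execution n S) (r : Req n Op) : Prop :=
  ∃ k R, G.Occurs k R (Action.tobDeliver r)

/-- The guarantees of reliable and of total order broadcast that do not depend on timing
assumptions, in an execution in which all replicas are correct. -/
structure NetworkGuarantees (G : Execution n S) : Prop where
  rb_sent : ∀ k R r, G.Occurs k R (Action.rbDeliver r) → ∃ j, j < k ∧ (G.out j).rbcast = some r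
  tob_sent : ∀ k R r, G.Occurs k R (Action.tobDeliver r) → ∃ j, j < k ∧ (G.out j).tobcast = some r
  rb_once : ∀ j k R r, G.Occurs j R (Action.rbDeliver r) → G.Occurs k R (Action.rbDeliver r) → j = k
  tob_once : ∀ j k R r, G.Occurs j R (Action.tobDeliver r) → G.Occurs k R (Action.tobDeliver r) →
    j = k
  /-- messages sent by reliable broadcast are eventually delivered everywhere -/
  rb_delivered : ∀ j r, (G.out j).rbcast = some r → ∀ R, ∃ k, G.Occurs k R (Action.rbDeliver r)
  /-- a message delivered by total order broadcast at one replica is delivered everywhere -/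
  tob_agreement : ∀ r, G.TobDelivered r → ∀ R, ∃ k, G.Occurs k R (Action.tobDeliver r)
  /-- all replicas deliver in the same total order -/
  tob_order : ∀ R R' r s j k k', j < k → G.Occurs j R (Action.tobDeliver r) →
    G.Occurs k R (Action.tobDeliver s) → G.Occurs k' R' (Action.tobDeliver s) →
    ∃ j', j' < k' ∧ G.Occurs j' R' (Action.tobDeliver r)

/-- Asynchronous runs: fair executions in which total order broadcast need not terminate, so that
messages sent by it may remain undelivered forever; it only cannot keep delivering messages forever
and starve one of them. -/
structure IsAsynchronousRun (G : Execution n S) : Prop where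
  fair : G.Fair
  network : G.NetworkGuarantees
  tob_no_starvation : {r | G.TobDelivered r}.Infinite →
    ∀ j r, (G.out j).tobcast = some r → G.TobDelivered r

end Execution

end ACT

/-!
A weak read-only operation influences no answer, so it may be made visible to every later weak
operation and arbitrated after all requests; what has to be controlled are the requests.

*Local states.* The trace of a replica is always its list `executed`, a prefix of the intended order
`committed ++ tentative`, followed by the requests still to be rolled back; a strong request enters
it only after having been committed and stays there (`RState.Consistent`, preserved by every step
since each of them is a `Move`).

*Convergence.* A request that is weak, or that is delivered by total order broadcast, gets a final
position: delivered requests come first, in the order of delivery, and the others follow in the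
order of timestamps and dots (`ReqLt`). Only finitely many requests precede it: if it is never
delivered, then only finitely many requests are delivered at all, and local clocks exceed every
timestamp. Hence the intended order of every replica eventually starts with the requests up to it
(`exists_eventually_prefix_order`), and fairness of rollbacks and executions makes this stable prefix
part of the trace for good (`eventually_prefix_executed`, `exists_eventually_prefix_state`).

*The abstract execution.* A weak operation sees the requests in the trace on which it is invoked, a
strong one those delivered before it. Arbitration is the final order of requests, and the order
perceived by a weak operation is that of its trace. Convergence gives eventual visibility and
convergent perceived arbitration. Visibility and session order both increase `effectTime`, the
first delivery for delivered strong operations and the invocation for all others, so there is no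
circular causality. The context of a weak operation, stripped of read-only events
(`DataType.F_restrict`), is isomorphic to the context of its trace, which yields the return values.

*Linearizability.* If total order broadcast delivers nothing and all operations are strong, then all
of them stay pending, in accordance with all guarantees of an asynchronous network; but
linearizability requires every strong operation to return a value.
-/

namespace ACT

universe u v

/-! ### Relations -/

theorem acyclic_of_lt {A : Type*} {rel : A → A → Prop} (f : A → ℕ)
    (h : ∀ x y, rel x y → f x < f y) : Acyclic rel := by
  intro x hx
  have key : ∀ y, Relation.TransGen rel x y → f x < f y := by
    intro y hy
    induction hy with
    | single h1 => exact h _ _ h1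
    | tail _ h1 ih => exact ih.trans (h _ _ h1)
  exact lt_irrefl _ (key x hx)

/-- The lexicographic refinement of the preorder pulled back along `f` by a total order. -/
def lexRel {A α : Type*} [LinearOrder α] (f : A → α) (rel : A → A → Prop) (x y : A) : Prop :=
  f x < f y ∨ f x = f y ∧ rel x y

theorem TotalOrderRel.lexRel {A α : Type*} [LinearOrder α] {rel : A → A → Prop}
    (h : TotalOrderRel rel) (f : A → α) : TotalOrderRel (lexRel f rel) := by
  refine ⟨⟨?_, ?_⟩, ?_⟩
  · rintro x (h1 | ⟨_, h1⟩)
    · exact lt_irrefl _ h1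
    · exact h.1.1 x h1
  · rintro x y z (h1 | ⟨h1, h1'⟩) (h2 | ⟨h2, h2'⟩)
    · exact Or.inl (h1.trans h2)
    · exact Or.inl (h2 ▸ h1)
    · exact Or.inl (h1 ▸ h2)
    · exact Or.inr ⟨h1.trans h2, h.1.2 _ _ _ h1' h2'⟩
  · intro x y hxy
    rcases lt_trichotomy (f x) (f y) with h1 | h1 | h1
    · exact Or.inl (Or.inl h1)
    · rcases h.2 x y hxy with h2 | h2
      · exact Or.inl (Or.inr ⟨h1, h2⟩)
      · exact Or.inr (Or.inr ⟨h1.symm, h2⟩)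
    · exact Or.inr (Or.inl h1)

theorem totalOrderRel_of_injective {A α : Type*} [LinearOrder α] {f : A → α}
    (hf : Function.Injective f) : TotalOrderRel (fun x y => f x < f y) :=
  ⟨⟨fun _ => lt_irrefl _, fun _ _ _ => lt_trans⟩, fun _ _ h => lt_or_gt_of_ne (hf.ne h)⟩

/-! ### Removing read-only events from a context -/

section Contexts

variable {Op : Type u} {Val : Type v}

/-- The event graph induced on the events satisfying `P`. -/
def Context.restrict (C : Context Op) (P : C.E → Prop) : Context Op where
  E := {x : C.E // P x}
  op x := C.op x
  vis x y := C.vis x y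
  ar x y := C.ar x y

theorem Context.IsOperationContext.restrict {C : Context Op} (hC : C.IsOperationContext)
    (P : C.E → Prop) : (C.restrict P).IsOperationContext := by
  obtain ⟨h1, h2, h3⟩ := hC
  refine ⟨Subtype.finite, ?_, ⟨⟨fun x => h3.1.1 x.1, fun x y z => h3.1.2 x.1 y.1 z.1⟩,
    fun x y hxy => h3.2 x.1 y.1 fun h => hxy (Subtype.ext h)⟩⟩
  intro x hx
  exact h2 x.1 (Relation.TransGen.lift (r := (C.restrict P).vis) Subtype.val (fun _ _ h => h) _ _ hx)

/-- Events labelled by read-only operations can be dropped from an operation context. -/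
theorem DataType.F_restrict (D : DataType Op Val) (q : Op) {C : Context Op}
    (hC : C.IsOperationContext) (P : C.E → Prop) (hP : ∀ x, ¬ P x → D.ReadOnly (C.op x)) :
    D.F q C = D.F q (C.restrict P) := by
  classical
  have := hC.1
  have key : ∀ s : Set C.E, s.Finite → (∀ x ∈ s, D.ReadOnly (C.op x)) →
      D.F q C = D.F q (C.restrict (· ∉ s)) := by
    intro s hs
    induction s, hs using Set.Finite.induction_on with
    | empty =>
      intro _
      refine D.iso_invariant q _ _ hC ⟨(Equiv.subtypeUnivEquiv (fun x => by simp)).symm, ?_⟩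
      exact ⟨fun _ => rfl, fun _ _ => Iff.rfl, fun _ _ => Iff.rfl⟩
    | @insert a s ha _ ih =>
      intro h
      have hr := hC.restrict (· ∉ s)
      have ha' : ∀ x : C.E, x ∉ insert a s → x ∉ s ∧ x ≠ a := fun x hx =>
        ⟨fun h1 => hx (Or.inr h1), fun h1 => hx (Or.inl h1)⟩
      rw [ih fun x hx => h x (Or.inr hx)]
      rw [h a (Or.inl rfl) q _ hr (⟨a, ha⟩ : {x // x ∉ s}) rfl]
      refine D.iso_invariant q _ _ (hr.restrict (· ≠ (⟨a, ha⟩ : {x // x ∉ s})))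
        ⟨⟨fun x => ⟨x.1.1, ?_⟩, fun x => ⟨⟨x.1, (ha' _ x.2).1⟩, ?_⟩, fun _ => rfl, fun _ => rfl⟩,
          fun _ => rfl, fun _ _ => Iff.rfl, fun _ _ => Iff.rfl⟩
      · rintro (h1 | h1)
        · exact x.2 (Subtype.ext h1)
        · exact x.1.2 h1
      · intro h1
        exact (ha' _ x.2).2 (congrArg Subtype.val h1)
  have h1 := key {x | ¬ P x} (Set.toFinite _) hP
  rw [h1]
  refine D.iso_invariant q _ _ (hC.restrict _) ⟨Equiv.subtypeEquivRight (by simp), ?_⟩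
  exact ⟨fun _ => rfl, fun _ _ => Iff.rfl, fun _ _ => Iff.rfl⟩

end Contexts

/-! ### Lists -/

section Lists

variable {A : Type*}

theorem longestCommonPrefix_prefix_left (l m : List A) : longestCommonPrefix l m <+: l := by
  induction l generalizing m with
  | nil => simp [longestCommonPrefix]
  | cons a l ih =>
    cases m with
    | nil => simp [longestCommonPrefix]
    | cons b m =>
      unfold longestCommonPrefix
      split_ifs
      · exact (List.prefix_cons_inj a).mpr (ih m)
      · exact List.nil_prefix

theorem longestCommonPrefix_prefix_right (l m : List A) : longestCommonPrefix l m <+: m := by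
  induction l generalizing m with
  | nil => simp [longestCommonPrefix]
  | cons a l ih =>
    cases m with
    | nil => simp [longestCommonPrefix]
    | cons b m =>
      unfold longestCommonPrefix
      split_ifs with h
      · subst h
        exact (List.prefix_cons_inj a).mpr (ih m)
      · exact List.nil_prefix

theorem prefix_longestCommonPrefix {p l m : List A} (hl : p <+: l) (hm : p <+: m) :
    p <+: longestCommonPrefix l m := by
  induction p generalizing l m with
  | nil => exact List.nil_prefix
  | cons a p ih =>
    obtain ⟨l', rfl⟩ := hl
    obtain ⟨m', rfl⟩ := hm
    simp only [List.cons_append, longestCommonPrefix, if_true]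
    exact (List.prefix_cons_inj a).mpr (ih (List.prefix_append _ _) (List.prefix_append _ _))

theorem longestCommonPrefix_of_prefix {l m : List A} (h : l <+: m) :
    longestCommonPrefix l m = l :=
  (longestCommonPrefix_prefix_left l m).eq_of_length_le
    (prefix_longestCommonPrefix List.prefix_rfl h).length_le

open Classical in
theorem append_filter_notMem {p l : List A} (h : p <+: l) (hl : l.Nodup) :
    p ++ l.filter (fun x => x ∉ p) = l := by
  obtain ⟨q, rfl⟩ := h
  rw [List.filter_append, List.filter_eq_nil_iff.mpr (by simp), List.nil_append,
    List.filter_eq_self.mpr]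
  intro x hx
  have := (List.nodup_append.mp hl).2.2
  simp only [decide_eq_true_eq]
  exact fun h1 => this x h1 x hx rfl

open Classical in
theorem idxOf_lt_iff_mem {q t : List A} {r : A} (hr : r ∉ q) (x : A) :
    (q ++ r :: t).idxOf x < (q ++ r :: t).idxOf r ↔ x ∈ q := by
  rw [List.idxOf_append_of_notMem hr, List.idxOf_cons_self, Nat.add_zero]
  by_cases hx : x ∈ q
  · rw [List.idxOf_append_of_mem hx]
    exact ⟨fun _ => hx, fun _ => List.idxOf_lt_length_of_mem hx⟩
  · rw [List.idxOf_append_of_notMem hx]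
    exact ⟨fun h => absurd h (by omega), fun h => absurd h hx⟩

/-- A list that is strictly sorted is determined by its set of elements. -/
theorem eq_of_pairwise_of_mem_iff {rel : A → A → Prop} (h1 : ∀ x, ¬ rel x x)
    (h2 : ∀ x y, rel x y → ¬ rel y x) {l m : List A} (hl : l.Pairwise rel) (hm : m.Pairwise rel)
    (h : ∀ x, x ∈ l ↔ x ∈ m) : l = m := by
  have hne : ∀ {x y}, rel x y → x ≠ y := fun {x y} h e => h1 x (e ▸ h)
  have hp : l.Perm m := (List.perm_ext_iff_of_nodup (hl.imp hne) (hm.imp hne)).mpr h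
  exact hp.eq_of_pairwise (fun a b _ _ h3 h4 => absurd h4 (h2 _ _ h3)) hl hm

end Lists

variable {n : ℕ} {Op : Type u} {Val : Type v}

/-! ### The order of tentative requests -/

namespace Req

theorem Before.irrefl (r : Req n Op) : ¬ r.Before r := by
  simp [Req.Before]

theorem Before.trans {r s t : Req n Op} (h : r.Before s) (h' : s.Before t) : r.Before t := by
  rcases h with h | ⟨h, h1 | ⟨h1, h2⟩⟩ <;> rcases h' with h' | ⟨h', h1' | ⟨h1', h2'⟩⟩
  · exact Or.inl (h.trans h')
  · exact Or.inl (h' ▸ h)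
  · exact Or.inl (h' ▸ h)
  · exact Or.inl (h ▸ h')
  · exact Or.inr ⟨h.trans h', Or.inl (h1.trans h1')⟩
  · exact Or.inr ⟨h.trans h', Or.inl (h1' ▸ h1)⟩
  · exact Or.inl (h ▸ h')
  · exact Or.inr ⟨h.trans h', Or.inl (h1 ▸ h1')⟩
  · exact Or.inr ⟨h.trans h', Or.inr ⟨h1.trans h1', h2.trans h2'⟩⟩

theorem Before.asymm {r s : Req n Op} (h : r.Before s) : ¬ s.Before r :=
  fun h' => Before.irrefl r (h.trans h')

theorem before_or_before {r s : Req n Op} (h : r.dot ≠ s.dot) : r.Before s ∨ s.Before r := by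
  unfold Req.Before
  rcases lt_trichotomy r.timestamp s.timestamp with h1 | h1 | h1
  · exact Or.inl (Or.inl h1)
  · rcases lt_trichotomy r.dot.1 s.dot.1 with h2 | h2 | h2
    · exact Or.inl (Or.inr ⟨h1, Or.inl h2⟩)
    · rcases lt_trichotomy r.dot.2 s.dot.2 with h3 | h3 | h3
      · exact Or.inl (Or.inr ⟨h1, Or.inr ⟨h2, h3⟩⟩)
      · exact absurd (Prod.ext h2 h3) h
      · exact Or.inr (Or.inr ⟨h1.symm, Or.inr ⟨h2.symm, h3⟩⟩)
    · exact Or.inr (Or.inr ⟨h1.symm, Or.inl h2⟩)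
  · exact Or.inr (Or.inl h1)

end Req

open Classical in
/-- The tentative list after the insertion of `r`. -/
noncomputable def sortedInsert (T : List (Req n Op)) (r : Req n Op) : List (Req n Op) :=
  T.filter (fun x => x.Before r) ++ [r] ++ T.filter (fun x => r.Before x)

theorem mem_sortedInsert {T : List (Req n Op)} {r : Req n Op}
    (h : ∀ x ∈ T, x.dot = r.dot → x = r) (x : Req n Op) :
    x ∈ sortedInsert T r ↔ x ∈ T ∨ x = r := by
  simp only [sortedInsert, List.mem_append, List.mem_filter, List.mem_singleton,
    decide_eq_true_eq]
  constructor
  · tauto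
  · rintro (hx | hx)
    · by_cases hd : x.dot = r.dot
      · exact Or.inl (Or.inr (h x hx hd))
      · rcases Req.before_or_before hd with h1 | h1 <;> tauto
    · tauto

theorem pairwise_sortedInsert {T : List (Req n Op)} (r : Req n Op)
    (hT : T.Pairwise Req.Before) : (sortedInsert T r).Pairwise Req.Before := by
  classical
  unfold sortedInsert
  simp only [List.append_assoc, List.singleton_append, List.pairwise_append, List.pairwise_cons,
    List.mem_cons, List.mem_filter, decide_eq_true_eq]
  refine ⟨hT.filter _, ⟨fun x hx => hx.2, hT.filter _⟩, ?_⟩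
  rintro a ⟨_, ha⟩ b (rfl | ⟨_, hb⟩)
  · exact ha
  · exact ha.trans hb

/-! ### Steps of a single replica -/

/-- The order in which a replica currently intends to execute the requests. -/
def RState.order (σ : RState n Op Val) : List (Req n Op) := σ.committed ++ σ.tentative

/-- The invariants of the local state of a replica. In particular the trace of the state object
consists of the executed requests followed by those still to be rolled back, and a strong request
enters the trace only after having been committed and is not rolled back afterwards. -/
structure RState.Consistent (σ : RState n Op Val) : Prop where
  order_eq : σ.executed ++ σ.toBeExecuted = σ.order
  state_eq : σ.state = σ.executed ++ σ.toBeRolledBack.reverse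
  nodup_state : σ.state.Nodup
  nodup_order : σ.order.Nodup
  weak_of_tentative : ∀ r ∈ σ.tentative, r.lvl = Level.weak
  of_strong : ∀ r ∈ σ.state, r.lvl = Level.strong → r ∈ σ.executed ∧ r ∈ σ.committed
  sorted : σ.tentative.Pairwise Req.Before

theorem RState.consistent_initial : (RState.initial n Op Val).Consistent := by
  constructor <;> simp [RState.initial, RState.order]

theorem RState.Consistent.executed_prefix {σ : RState n Op Val} (h : σ.Consistent) :
    σ.executed <+: σ.order := ⟨_, h.order_eq⟩

theorem RState.Consistent.executed_prefix_state {σ : RState n Op Val} (h : σ.Consistent) :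
    σ.executed <+: σ.state := ⟨_, h.state_eq.symm⟩

/-- The effect of a step from `σ` to `τ` that neither executes nor rolls back a request and leaves
the lists `C` of committed and `T` of tentative requests. -/
structure Reorder (σ τ : RState n Op Val) (C T : List (Req n Op)) : Prop where
  committed : τ.committed = C
  tentative : τ.tentative = T
  state : τ.state = σ.state
  executed : τ.executed = longestCommonPrefix σ.executed (C ++ T)
  order : τ.executed ++ τ.toBeExecuted = C ++ T
  trace : τ.executed ++ τ.toBeRolledBack.reverse = σ.executed ++ σ.toBeRolledBack.reverse

theorem Reorder.adjustExecution {σ : RState n Op Val} {o : List (Req n Op)}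
    (he : σ.executed.Nodup) (ho : o.Nodup) (hO : o = σ.committed ++ σ.tentative) :
    Reorder σ (adjustExecution σ o) σ.committed σ.tentative := by
  subst hO
  refine ⟨rfl, rfl, rfl, rfl, ?_, ?_⟩
  · exact append_filter_notMem (longestCommonPrefix_prefix_right _ _) ho
  · simp only [ACT.adjustExecution, List.reverse_append, List.reverse_reverse]
    rw [← List.append_assoc, append_filter_notMem (longestCommonPrefix_prefix_left _ _) he]

theorem Reorder.idle {σ τ : RState n Op Val} (h : σ.Consistent) (h1 : τ.committed = σ.committed)
    (h2 : τ.tentative = σ.tentative) (h3 : τ.state = σ.state) (h4 : τ.executed = σ.executed)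
    (h5 : τ.toBeExecuted = σ.toBeExecuted) (h6 : τ.toBeRolledBack = σ.toBeRolledBack) :
    Reorder σ τ σ.committed σ.tentative :=
  ⟨h1, h2, h3, h4.trans (longestCommonPrefix_of_prefix h.executed_prefix).symm,
    by rw [h4, h5]; exact h.order_eq, by rw [h4, h6]⟩

/-- The possible effects of an event on the state of a replica, up to the request counter and the
bookkeeping of responses. -/
inductive Move (σ τ : RState n Op Val) : Prop
  | idle (h : Reorder σ τ σ.committed σ.tentative)
  | insert (r : Req n Op) (hw : r.lvl = Level.weak) (hd : ∀ x ∈ σ.tentative, x.dot = r.dot → x = r)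
      (hr : r ∉ σ.committed) (h : Reorder σ τ σ.committed (sortedInsert σ.tentative r))
  | commit (r : Req n Op) (T : List (Req n Op)) (hr : r ∉ σ.committed)
      (hT : T.Sublist σ.tentative) (hm : ∀ x, x ∈ T ↔ x ∈ σ.tentative ∧ x ≠ r)
      (h : Reorder σ τ (σ.committed ++ [r]) T)
  | rollback (r : Req n Op) (hr : σ.toBeRolledBack = r :: τ.toBeRolledBack)
      (hs : τ.state = StateObject.rollback σ.state r) (hC : τ.committed = σ.committed)
      (hT : τ.tentative = σ.tentative) (he : τ.executed = σ.executed)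
      (hb : τ.toBeExecuted = σ.toBeExecuted)
  | execute (r : Req n Op) (hr : σ.toBeRolledBack = []) (hb : σ.toBeExecuted = r :: τ.toBeExecuted)
      (hr' : τ.toBeRolledBack = []) (hs : τ.state = σ.state ++ [r]) (hC : τ.committed = σ.committed)
      (hT : τ.tentative = σ.tentative) (he : τ.executed = σ.executed ++ [r])

theorem RState.Consistent.prefix_executed {σ : RState n Op Val} (hσ : σ.Consistent)
    {r : Req n Op} (hr : r ∈ σ.executed) {c d : List (Req n Op)} (h : σ.committed = c ++ r :: d) :
    c ++ [r] <+: σ.executed := by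
  have hp : c ++ [r] <+: σ.order :=
    List.IsPrefix.trans ⟨d, by rw [h]; simp⟩ (List.prefix_append _ σ.tentative)
  rcases List.prefix_or_prefix_of_prefix hp hσ.executed_prefix with h3 | h3
  · exact h3
  · rcases List.prefix_concat_iff.mp h3 with h4 | h4
    · rw [h4]
    · have h5 : r ∈ c := h4.subset hr
      have h6 := hσ.nodup_order.sublist hp.sublist
      exact absurd rfl ((List.nodup_append.mp h6).2.2 r h5 r (by simp))

theorem Reorder.consistent {σ τ : RState n Op Val} {C T : List (Req n Op)} (h : Reorder σ τ C T)
    (hσ : σ.Consistent) (hC : σ.committed <+: C) (hn : (C ++ T).Nodup)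
    (hw : ∀ r ∈ T, r.lvl = Level.weak) (hs : T.Pairwise Req.Before) : τ.Consistent := by
  have hτ : τ.order = C ++ T := by rw [RState.order, h.committed, h.tentative]
  refine ⟨h.order.trans hτ.symm, by rw [h.state, hσ.state_eq, h.trace], h.state ▸ hσ.nodup_state,
    hτ ▸ hn, h.tentative ▸ hw, ?_, h.tentative ▸ hs⟩
  intro r hr hl
  rw [h.state] at hr
  obtain ⟨h1, h2⟩ := hσ.of_strong r hr hl
  rw [h.committed]
  refine ⟨?_, hC.subset h2⟩
  -- The committed requests up to `r` are a common prefix of `executed` and of the new order.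
  obtain ⟨c, d, hcd⟩ := List.append_of_mem h2
  have hp : c ++ [r] <+: σ.committed := ⟨d, by rw [hcd]; simp⟩
  have hp2 := hσ.prefix_executed h1 hcd
  rw [h.executed]
  exact (prefix_longestCommonPrefix hp2 ((hp.trans hC).trans (List.prefix_append _ _))).subset
    (by simp)

theorem RState.Consistent.nodup_insert {σ : RState n Op Val} (hσ : σ.Consistent) {r : Req n Op}
    (hd : ∀ x ∈ σ.tentative, x.dot = r.dot → x = r) (hr : r ∉ σ.committed) :
    (σ.committed ++ sortedInsert σ.tentative r).Nodup := by
  have hn := List.nodup_append.mp (show (σ.committed ++ σ.tentative).Nodup from hσ.nodup_order)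
  refine List.nodup_append.mpr ⟨hn.1, (pairwise_sortedInsert r hσ.sorted).imp ?_, ?_⟩
  · rintro a b h rfl
    exact Req.Before.irrefl _ h
  · rintro a ha b hb rfl
    rcases (mem_sortedInsert hd a).mp hb with h1 | rfl
    · exact hn.2.2 a ha a h1 rfl
    · exact hr ha

theorem RState.Consistent.nodup_commit {σ : RState n Op Val} (hσ : σ.Consistent) {r : Req n Op}
    (hr : r ∉ σ.committed) {T : List (Req n Op)} (hT : T.Sublist σ.tentative)
    (hm : ∀ x, x ∈ T ↔ x ∈ σ.tentative ∧ x ≠ r) : (σ.committed ++ [r] ++ T).Nodup := by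
  have hn := List.nodup_append.mp (show (σ.committed ++ σ.tentative).Nodup from hσ.nodup_order)
  refine List.nodup_append.mpr ⟨List.nodup_append.mpr ⟨hn.1, by simp, ?_⟩, hn.2.1.sublist hT, ?_⟩
  · rintro a ha b hb rfl
    exact hr (List.mem_singleton.mp hb ▸ ha)
  · rintro a ha b hb rfl
    rcases List.mem_append.mp ha with h1 | h1
    · exact hn.2.2 a h1 a ((hm a).mp hb).1 rfl
    · exact ((hm a).mp hb).2 (by simpa using h1)

theorem Move.consistent {σ τ : RState n Op Val} (h : Move σ τ) (hσ : σ.Consistent) :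
    τ.Consistent := by
  cases h with
  | idle h =>
    exact h.consistent hσ List.prefix_rfl hσ.nodup_order hσ.weak_of_tentative hσ.sorted
  | insert r hw hd hr h =>
    refine h.consistent hσ List.prefix_rfl (hσ.nodup_insert hd hr) ?_
      (pairwise_sortedInsert r hσ.sorted)
    · intro x hx
      rcases (mem_sortedInsert hd x).mp hx with h1 | rfl
      · exact hσ.weak_of_tentative x h1
      · exact hw
  | commit r T hr hT hm h =>
    refine h.consistent hσ (List.prefix_append _ _) (hσ.nodup_commit hr hT hm) ?_ ?_
    · exact fun x hx => hσ.weak_of_tentative x ((hm x).mp hx).1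
    · exact hσ.sorted.sublist hT
  | rollback r hr hs hC hT he hb =>
    have hτ : τ.order = σ.order := by rw [RState.order, hC, hT, RState.order]
    have h1 : σ.state = σ.executed ++ τ.toBeRolledBack.reverse ++ [r] := by
      rw [hσ.state_eq, hr]; simp
    have h2 : τ.state = σ.executed ++ τ.toBeRolledBack.reverse := by
      classical
      have h3 := h1 ▸ hσ.nodup_state
      have h4 : ∀ x ∈ σ.executed ++ τ.toBeRolledBack.reverse, x ≠ r := by
        intro x hx e
        exact (List.nodup_append.mp h3).2.2 x hx r (by simp) e
      rw [hs, StateObject.rollback, h1, List.filter_append]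
      rw [List.filter_eq_self.mpr (by simpa using h4)]
      simp
    have h3 : τ.state.Sublist σ.state := by rw [h1, h2]; exact List.sublist_append_left _ _
    refine ⟨by rw [he, hb, hτ, hσ.order_eq], by rw [h2, he], hσ.nodup_state.sublist h3,
      hτ ▸ hσ.nodup_order, hT ▸ hσ.weak_of_tentative, ?_, hT ▸ hσ.sorted⟩
    rw [he, hC]
    exact fun x hx => hσ.of_strong x (h3.subset hx)
  | execute r hr hb hr' hs hC hT he =>
    have hτ : τ.order = σ.order := by rw [RState.order, hC, hT, RState.order]
    have h1 : σ.state = σ.executed := by rw [hσ.state_eq, hr]; simp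
    have h2 : τ.executed ++ τ.toBeExecuted = σ.order := by
      rw [← hσ.order_eq, he, hb]; simp
    have h3 : τ.state = τ.executed := by rw [hs, he, h1]
    refine ⟨by rw [h2, hτ], by rw [h3, hr']; simp, ?_, hτ ▸ hσ.nodup_order,
      hT ▸ hσ.weak_of_tentative, ?_, hT ▸ hσ.sorted⟩
    · rw [h3]
      exact hσ.nodup_order.sublist (h2 ▸ List.sublist_append_left _ _)
    · intro x hx hl
      rw [hC]
      refine ⟨h3 ▸ hx, ?_⟩
      rw [h3] at hx
      have h4 : x ∈ σ.order := h2 ▸ List.mem_append_left _ hx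
      rcases List.mem_append.mp h4 with h5 | h5
      · exact h5
      · rw [hσ.weak_of_tentative x h5] at hl
        cases hl

theorem Move.committed_eq_or {σ τ : RState n Op Val} (h : Move σ τ) :
    τ.committed = σ.committed ∨ ∃ r, r ∉ σ.committed ∧ τ.committed = σ.committed ++ [r] := by
  cases h with
  | idle h => exact Or.inl h.committed
  | insert r hw hd hr h => exact Or.inl h.committed
  | commit r T hr hT hm h => exact Or.inr ⟨r, hr, h.committed⟩
  | rollback r hr hs hC hT he hb => exact Or.inl hC
  | execute r hr hb hr' hs hC hT he => exact Or.inl hC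

theorem Move.committed_prefix {σ τ : RState n Op Val} (h : Move σ τ) :
    σ.committed <+: τ.committed := by
  rcases h.committed_eq_or with h | ⟨r, _, h⟩ <;> rw [h]
  exact List.prefix_append _ _

theorem Move.mem_order {σ τ : RState n Op Val} (h : Move σ τ) {x : Req n Op}
    (hx : x ∈ σ.order) : x ∈ τ.order := by
  unfold RState.order at *
  cases h with
  | idle h => rwa [h.committed, h.tentative]
  | insert r hw hd hr h =>
    rw [h.committed, h.tentative]
    rw [List.mem_append, mem_sortedInsert hd] at *
    tauto
  | commit r T hr hT hm h =>
    rw [h.committed, h.tentative]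
    simp only [List.mem_append, hm, List.mem_singleton] at *
    tauto
  | rollback r hr hs hC hT he hb => rwa [hC, hT]
  | execute r hr hb hr' hs hC hT he => rwa [hC, hT]

/-- A common prefix of the intended order before and after a step stays executed. -/
theorem Move.prefix_executed {σ τ : RState n Op Val} (h : Move σ τ)
    {p : List (Req n Op)} (hp : p <+: σ.executed) (hp' : p <+: τ.order) : p <+: τ.executed := by
  have hr : ∀ {C T}, Reorder σ τ C T → p <+: τ.executed := by
    intro C T h
    rw [RState.order, h.committed, h.tentative] at hp'
    rw [h.executed]
    exact prefix_longestCommonPrefix hp hp'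
  cases h with
  | idle h => exact hr h
  | insert r _ _ _ h => exact hr h
  | commit r _ _ _ _ h => exact hr h
  | rollback r _ hs hC hT he hb => exact he ▸ hp
  | execute r _ hb hr' hs hC hT he => exact he ▸ hp.trans (List.prefix_append _ _)

/-- As long as the executed requests do not change, the number of requests waiting to be rolled
back does not increase. -/
theorem Move.length_toBeRolledBack_le {σ τ : RState n Op Val} (h : Move σ τ)
    (he : τ.executed = σ.executed) : τ.toBeRolledBack.length ≤ σ.toBeRolledBack.length := by
  have hr : ∀ {C T}, Reorder σ τ C T → τ.toBeRolledBack.length ≤ σ.toBeRolledBack.length := by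
    intro C T h
    have := h.trace
    rw [he] at this
    have := congrArg List.length (List.append_cancel_left this)
    simpa using this.le
  cases h with
  | idle h => exact hr h
  | insert r _ _ _ h => exact hr h
  | commit r _ _ _ _ h => exact hr h
  | rollback r hr hs hC hT he hb => rw [hr]; simp
  | execute r _ hb hr' hs hC hT he => rw [hr']; simp

/-! ### The steps of the protocol are moves -/

theorem RState.Consistent.nodup_executed {σ : RState n Op Val} (h : σ.Consistent) : σ.executed.Nodup :=
  h.nodup_state.sublist h.executed_prefix_state.sublist

/-- Inserting into the tentative list, possibly after changes of fields that do not matter. -/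
theorem Move.of_insertIntoTentative {σ σ' : RState n Op Val} (hσ : σ.Consistent) {r : Req n Op}
    (h1 : σ'.committed = σ.committed) (h2 : σ'.tentative = σ.tentative)
    (h3 : σ'.state = σ.state) (h4 : σ'.executed = σ.executed)
    (h5 : σ'.toBeRolledBack = σ.toBeRolledBack) (hw : r.lvl = Level.weak)
    (hd : ∀ x ∈ σ.tentative, x.dot = r.dot → x = r) (hr : r ∉ σ.committed) :
    Move σ (insertIntoTentative σ' r) := by
  refine Move.insert r hw hd hr ?_
  have key := Reorder.adjustExecution (σ := { σ' with tentative := sortedInsert σ'.tentative r })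
    (o := σ'.committed ++ sortedInsert σ'.tentative r) (by rw [h4]; exact hσ.nodup_executed)
    (by rw [h1, h2]; exact hσ.nodup_insert hd hr) rfl
  refine ⟨key.committed.trans h1, key.tentative.trans ?_, key.state.trans h3, ?_, ?_, ?_⟩
  · simp only [h2]
  · exact key.executed.trans (by simp only [h1, h2, h4])
  · exact key.order.trans (by simp only [h1, h2])
  · exact key.trace.trans (by simp only [h4, h5])

theorem Move.of_commit {σ : RState n Op Val} (hσ : σ.Consistent) {r : Req n Op}
    (hr : r ∉ σ.committed) : Move σ (ACT.commit σ r).1 ∧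
      (ACT.commit σ r).1.committed = σ.committed ++ [r] := by
  classical
  set T := σ.tentative.filter (fun x => x ≠ r) with hT
  have hm : ∀ x, x ∈ T ↔ x ∈ σ.tentative ∧ x ≠ r := by simp [hT]
  have hsub : T.Sublist σ.tentative := List.filter_sublist
  have key := Reorder.adjustExecution (o := σ.committed ++ [r] ++ T)
    (σ := { σ with committed := σ.committed ++ [r], tentative := T }) 
    (show σ.executed.Nodup from hσ.nodup_executed) (hσ.nodup_commit hr hsub hm) rfl
  obtain ⟨f, hf⟩ : ∃ f, (ACT.commit σ r).1 =
      { adjustExecution { σ with committed := σ.committed ++ [r], tentative := T }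
        (σ.committed ++ [r] ++ T) with reqsAwaitingResp := f } := by
    unfold ACT.commit
    simp only
    rw [← hT]
    split_ifs
    · exact ⟨_, rfl⟩
    · exact ⟨_, rfl⟩
  rw [hf]
  exact ⟨Move.commit r T hr hsub hm
    ⟨key.committed, key.tentative, key.state, key.executed, key.order, key.trace⟩, rfl⟩

theorem Move.of_rollbackStep {σ τ : RState n Op Val} (h : rollbackStep σ = some τ) :
    Move σ τ ∧ τ.committed = σ.committed ∧
      τ.toBeRolledBack.length < σ.toBeRolledBack.length := by
  unfold rollbackStep at h
  split at h
  · cases h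
  · rename_i r t hr
    cases h
    exact ⟨Move.rollback r hr rfl rfl rfl rfl rfl, rfl, by simp [hr]⟩

theorem Move.of_executeStep {D : DataType Op Val} {σ τ : RState n Op Val} {o : Output n Op Val}
    (h : executeStep D σ = some (τ, o)) :
    Move σ τ ∧ τ.committed = σ.committed ∧ τ.executed.length = σ.executed.length + 1 ∧
      o.tobcast = none ∧
      ∀ r v, o.answered = some (r, v) → r.lvl = Level.weak ∨ r ∈ σ.committed := by
  unfold executeStep at h
  split at h
  · rename_i r t hr hb
    simp only [StateObject.execute] at h
    split_ifs at h with h1 h2 <;> cases h <;>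
      refine ⟨Move.execute r hr hb hr rfl rfl rfl rfl, rfl, by simp, rfl, ?_⟩
    · rintro _ _ h3
      cases h3
      exact h2
    · intro _ _ h3
      cases h3
    · intro _ _ h3
      cases h3
  · cases h

theorem commit_output (σ : RState n Op Val) (r : Req n Op) :
    (commit σ r).2.tobcast = none ∧ ∀ s v, (commit σ r).2.answered = some (s, v) → s = r := by
  unfold commit
  simp only
  split_ifs
  · refine ⟨rfl, ?_⟩
    intro s v h
    simp only [Option.map_eq_some_iff] at h
    obtain ⟨_, _, h⟩ := h
    exact (congrArg Prod.fst h).symm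
  · refine ⟨rfl, ?_⟩
    intro s v h
    cases h

variable {S : Spec Op Val}

/-! ### Requests issued in a trajectory -/

/-- The request record that replica `i` creates at local time `clock` in the state `σ`. -/
def newRequest (i : Fin n) (clock : ℤ) (op : Op) (lvl : Level) (σ : RState n Op Val) :
    Req n Op where
  timestamp := clock
  dot := (i, σ.currEventNo + 1)
  ctx := (σ.executed.map Req.dot).toFinset ∪ (σ.toBeRolledBack.map Req.dot).toFinset
  lvl := lvl
  op := op

theorem invokeStep_readOnly (D : DataType Op Val) (i : Fin n) (t : ℤ) {op : Op}
    (h : D.ReadOnly op) (σ : RState n Op Val) :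
    invokeStep D i t op Level.weak σ =
      (σ, { Output.silent n Op Val with returned := some (StateObject.respond D σ.state op) }) := by
  unfold invokeStep
  rw [if_pos ⟨rfl, h⟩]

theorem invokeStep_weak (D : DataType Op Val) (i : Fin n) (t : ℤ) {op : Op}
    (h : ¬ D.ReadOnly op) (σ : RState n Op Val) :
    invokeStep D i t op Level.weak σ =
      (insertIntoTentative
        { σ with
          currEventNo := σ.currEventNo + 1
          state := StateObject.rollback (σ.state ++ [newRequest i t op Level.weak σ])
            (newRequest i t op Level.weak σ) } (newRequest i t op Level.weak σ),
        { Output.silent n Op Val with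
          rbcast := some (newRequest i t op Level.weak σ)
          tobcast := some (newRequest i t op Level.weak σ)
          returned := some (StateObject.respond D σ.state op) }) := by
  unfold invokeStep
  rw [if_neg fun h' => h h'.2]
  rfl

open Classical in
theorem invokeStep_strong (D : DataType Op Val) (i : Fin n) (t : ℤ) (op : Op)
    (σ : RState n Op Val) :
    invokeStep D i t op Level.strong σ =
      ({ σ with
          currEventNo := σ.currEventNo + 1
          reqsAwaitingResp := Function.update σ.reqsAwaitingResp
            (newRequest i t op Level.strong σ) (some none) },
        { Output.silent n Op Val with tobcast := some (newRequest i t op Level.strong σ) }) := by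
  unfold invokeStep
  rw [if_neg fun h' => nomatch h'.1]
  rfl

theorem commit_fields (σ : RState n Op Val) (r : Req n Op) :
    (commit σ r).1.currEventNo = σ.currEventNo ∧ (commit σ r).1.tentative ⊆ σ.tentative ∧
      (commit σ r).2.rbcast = none := by
  unfold commit
  simp only
  split_ifs <;> exact ⟨rfl, fun x hx => List.mem_of_mem_filter hx, rfl⟩

theorem executeStep_fields {D : DataType Op Val} {σ τ : RState n Op Val} {o : Output n Op Val}
    (h : executeStep D σ = some (τ, o)) :
    τ.currEventNo = σ.currEventNo ∧ τ.tentative = σ.tentative ∧ o.rbcast = none := by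
  unfold executeStep at h
  split at h
  · simp only at h
    split_ifs at h <;> cases h <;> exact ⟨rfl, rfl, rfl⟩
  · cases h

namespace Trajectory

variable (G : Trajectory n S)

/-- The state, just before the event `k`, of the replica that performs it. -/
def before (k : ℕ) : RState n Op Val := G.config k (G.event k).rep

/-- The state, just after the event `k`, of the replica that performs it. -/
def after (k : ℕ) : RState n Op Val := G.config (k + 1) (G.event k).rep

theorem step_eq (k : ℕ) : step S.dataType (G.event k).rep (G.event k).clock (G.before k)
    (G.event k).act = some (G.after k, G.out k) := G.config_step k

theorem invoke_eq {k c : ℕ} {op : Op} {l : Level} (h : (G.event k).act = Action.invoke c op l) :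
    G.after k = (invokeStep S.dataType (G.event k).rep (G.event k).clock op l (G.before k)).1 ∧
      G.out k = (invokeStep S.dataType (G.event k).rep (G.event k).clock op l (G.before k)).2 := by
  have := G.step_eq k
  rw [h] at this
  have := Option.some.inj this
  exact ⟨(congrArg Prod.fst this).symm, (congrArg Prod.snd this).symm⟩

theorem rbDeliver_eq {k : ℕ} {r : Req n Op} (h : (G.event k).act = Action.rbDeliver r) :
    rbDeliverStep (G.event k).rep r (G.before k) = G.after k ∧ G.out k = Output.silent n Op Val := by
  have := G.step_eq k
  rw [h] at this
  have := Option.some.inj this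
  exact ⟨congrArg Prod.fst this, (congrArg Prod.snd this).symm⟩

theorem tobDeliver_eq {k : ℕ} {r : Req n Op} (h : (G.event k).act = Action.tobDeliver r) :
    G.after k = (commit (G.before k) r).1 ∧ G.out k = (commit (G.before k) r).2 := by
  have := G.step_eq k
  rw [h] at this
  have := Option.some.inj this
  exact ⟨(congrArg Prod.fst this).symm, (congrArg Prod.snd this).symm⟩

theorem rollback_eq {k : ℕ} (h : (G.event k).act = Action.rollback) :
    rollbackStep (G.before k) = some (G.after k) ∧ G.out k = Output.silent n Op Val := by
  have := G.step_eq k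
  rw [h] at this
  obtain ⟨τ, h1, h2⟩ := Option.map_eq_some_iff.mp this
  obtain ⟨h3, h4⟩ := Prod.mk.inj h2
  exact ⟨h3 ▸ h1, h4.symm⟩

theorem execute_eq {k : ℕ} (h : (G.event k).act = Action.execute) :
    executeStep S.dataType (G.before k) = some (G.after k, G.out k) := by
  have := G.step_eq k
  rwa [h] at this

/-- Only invocations that are not weak and read-only broadcast a request. -/
theorem tobcast_eq_some {k : ℕ} {r : Req n Op} (h : (G.out k).tobcast = some r) :
    ∃ c op l, (G.event k).act = Action.invoke c op l ∧ ¬ (l = Level.weak ∧ S.dataType.ReadOnly op) ∧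
      r = newRequest (G.event k).rep (G.event k).clock op l (G.before k) ∧
      (G.after k).currEventNo = (G.before k).currEventNo + 1 := by
  match ha : (G.event k).act with
  | Action.invoke c op l =>
    have h1 := G.invoke_eq ha
    refine ⟨c, op, l, rfl, ?_⟩
    cases l with
    | strong =>
      rw [invokeStep_strong] at h1
      rw [h1.2] at h
      rw [h1.1]
      exact ⟨fun h => (nomatch h.1), (Option.some.inj h).symm, rfl⟩
    | weak =>
      by_cases hro : S.dataType.ReadOnly op
      · rw [invokeStep_readOnly _ _ _ hro] at h1
        rw [h1.2] at h
        cases h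
      · rw [invokeStep_weak _ _ _ hro] at h1
        rw [h1.2] at h
        rw [h1.1]
        exact ⟨fun h => hro h.2, (Option.some.inj h).symm, rfl⟩
  | Action.rbDeliver r =>
    rw [(G.rbDeliver_eq ha).2] at h
    cases h
  | Action.tobDeliver r =>
    have := (commit_output (G.before k) r).1
    rw [← (G.tobDeliver_eq ha).2, h] at this
    cases this
  | Action.rollback =>
    rw [(G.rollback_eq ha).2] at h
    cases h
  | Action.execute =>
    have := (Move.of_executeStep (G.execute_eq ha)).2.2.2.1
    rw [h] at this
    cases this

theorem rbcast_eq_some {k : ℕ} {r : Req n Op} (h : (G.out k).rbcast = some r) :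
    (G.out k).tobcast = some r ∧ r.lvl = Level.weak := by
  match ha : (G.event k).act with
  | Action.invoke c op l =>
    have h1 := G.invoke_eq ha
    cases l with
    | strong =>
      rw [invokeStep_strong] at h1
      rw [h1.2] at h
      cases h
    | weak =>
      by_cases hro : S.dataType.ReadOnly op
      · rw [invokeStep_readOnly _ _ _ hro] at h1
        rw [h1.2] at h
        cases h
      · rw [invokeStep_weak _ _ _ hro] at h1
        rw [h1.2] at h ⊢
        exact ⟨h, Option.some.inj h ▸ rfl⟩
  | Action.rbDeliver r =>
    rw [(G.rbDeliver_eq ha).2] at h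
    cases h
  | Action.tobDeliver r =>
    rw [(G.tobDeliver_eq ha).2, (commit_fields _ r).2.2] at h
    cases h
  | Action.rollback =>
    rw [(G.rollback_eq ha).2] at h
    cases h
  | Action.execute =>
    rw [(executeStep_fields (G.execute_eq ha)).2.2] at h
    cases h

theorem rbcast_of_weak {k : ℕ} {r : Req n Op} (h : (G.out k).tobcast = some r)
    (hw : r.lvl = Level.weak) : (G.out k).rbcast = some r := by
  obtain ⟨c, op, l, ha, hl, hr, _⟩ := G.tobcast_eq_some h
  have hl' : l = Level.weak := by rw [hr] at hw; exact hw
  subst hl'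
  have h1 := G.invoke_eq ha
  rw [invokeStep_weak _ _ _ fun h => hl ⟨rfl, h⟩] at h1
  rw [h1.2, hr]

theorem currEventNo_le_succ (k : ℕ) (R : Fin n) :
    (G.config k R).currEventNo ≤ (G.config (k + 1) R).currEventNo := by
  by_cases hR : R = (G.event k).rep
  · subst hR
    change (G.before k).currEventNo ≤ (G.after k).currEventNo
    match ha : (G.event k).act with
    | Action.invoke c op l =>
      have h1 := G.invoke_eq ha
      cases l with
      | strong =>
        rw [invokeStep_strong] at h1
        rw [h1.1]
        exact Nat.le_succ _
      | weak =>
        by_cases hro : S.dataType.ReadOnly op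
        · rw [invokeStep_readOnly _ _ _ hro] at h1
          rw [h1.1]
        · rw [invokeStep_weak _ _ _ hro] at h1
          rw [h1.1]
          exact Nat.le_succ _
    | Action.rbDeliver r =>
      rw [← (G.rbDeliver_eq ha).1]
      unfold rbDeliverStep
      split_ifs <;> exact le_rfl
    | Action.tobDeliver r => rw [(G.tobDeliver_eq ha).1, (commit_fields _ r).1]
    | Action.rollback =>
      have h1 := (G.rollback_eq ha).1
      unfold rollbackStep at h1
      split at h1
      · cases h1
      · rw [← Option.some.inj h1]
    | Action.execute => rw [(executeStep_fields (G.execute_eq ha)).1]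
  · rw [G.config_other k R hR]

theorem currEventNo_mono (R : Fin n) : Monotone fun k => (G.config k R).currEventNo :=
  monotone_nat_of_le_succ fun k => G.currEventNo_le_succ k R

/-- Dots identify requests: two events never issue requests with the same dot. -/
theorem eq_of_dot_eq {j k : ℕ} {r s : Req n Op} (hr : (G.out j).tobcast = some r)
    (hs : (G.out k).tobcast = some s) (h : r.dot = s.dot) : j = k := by
  wlog hjk : j ≤ k generalizing j k r s
  · exact (this hs hr h.symm (le_of_not_ge hjk)).symm
  obtain ⟨_, _, _, _, _, hr, hr'⟩ := G.tobcast_eq_some hr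
  obtain ⟨_, _, _, _, _, hs, _⟩ := G.tobcast_eq_some hs
  rcases hjk.eq_or_lt with h1 | h1
  · exact h1
  have h2 : (G.event j).rep = (G.event k).rep := by
    have := congrArg Prod.fst h
    rwa [hr, hs] at this
  have h3 : (G.before j).currEventNo + 1 = (G.before k).currEventNo + 1 := by
    have := congrArg Prod.snd h
    rwa [hr, hs] at this
  have h4 : (G.after j).currEventNo ≤ (G.before k).currEventNo := by
    unfold after before
    rw [h2]
    exact G.currEventNo_mono _ h1
  omega

/-- The request `r` has been issued before the event `k`. -/
def IssuedBefore (k : ℕ) (r : Req n Op) : Prop := ∃ j, j < k ∧ (G.out j).tobcast = some r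

variable {G} in
theorem IssuedBefore.mono {k m : ℕ} {r : Req n Op} (h : G.IssuedBefore k r) (hkm : k ≤ m) :
    G.IssuedBefore m r := by
  obtain ⟨j, hj, h⟩ := h
  exact ⟨j, by omega, h⟩

theorem IssuedBefore.eq_of_dot_eq {k m : ℕ} {r s : Req n Op} (hr : G.IssuedBefore k r)
    (hs : G.IssuedBefore m s) (h : r.dot = s.dot) : r = s := by
  obtain ⟨j, _, hr⟩ := hr
  obtain ⟨j', _, hs⟩ := hs
  obtain rfl := G.eq_of_dot_eq hr hs h
  exact Option.some.inj (hr.symm.trans hs)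

end Trajectory

/-! ### The invariants along an execution -/

namespace Execution

variable (G : Execution n S)

/-- The invariants of the configuration before the event `k`: all replicas are in consistent
states, the requests they know have been issued, and the committed requests are those delivered
by total order broadcast. -/
structure Invariant (k : ℕ) : Prop where
  consistent : ∀ R, (G.config k R).Consistent
  issued : ∀ R, ∀ r ∈ (G.config k R).order, G.IssuedBefore k r
  issued_state : ∀ R, ∀ r ∈ (G.config k R).state, G.IssuedBefore k r
  mem_committed : ∀ R r, r ∈ (G.config k R).committed ↔
    ∃ j, j < k ∧ G.Occurs j R (Action.tobDeliver r)

variable {G}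

theorem Invariant.notMem_of_new {k : ℕ} (h : G.Invariant k) {r : Req n Op}
    (hr : (G.out k).tobcast = some r) {R : Fin n} :
    (∀ x ∈ (G.config k R).order, x.dot ≠ r.dot) ∧ ∀ x ∈ (G.config k R).state, x.dot ≠ r.dot := by
  constructor
  · intro x hx e
    obtain ⟨j, hj, hx⟩ := h.issued R x hx
    exact hj.ne (G.eq_of_dot_eq hx hr e)
  · intro x hx e
    obtain ⟨j, hj, hx⟩ := h.issued_state R x hx
    exact hj.ne (G.eq_of_dot_eq hx hr e)

/-- Every event is a move of the replica performing it. Besides, the committed requests change only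
by deliveries, and requests become known only after they have been issued. -/
theorem Invariant.move_after {k : ℕ} (h : G.Invariant k) (N : G.NetworkGuarantees) :
    Move (G.before k) (G.after k) ∧
    (∀ r, r ∈ (G.after k).committed ↔
      r ∈ (G.before k).committed ∨ (G.event k).act = Action.tobDeliver r) ∧
    (∀ r ∈ (G.after k).order, r ∈ (G.before k).order ∨ G.IssuedBefore (k + 1) r) ∧
    (∀ r ∈ (G.after k).state, r ∈ (G.before k).state ∨ r ∈ (G.before k).order) := by
  have hσ : (G.before k).Consistent := h.consistent _
  suffices hmain : Move (G.before k) (G.after k) ∧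
      (∀ r, r ∈ (G.after k).committed ↔
        r ∈ (G.before k).committed ∨ (G.event k).act = Action.tobDeliver r) ∧
      (∀ r ∈ (G.after k).tentative, r ∈ (G.before k).tentative ∨ G.IssuedBefore (k + 1) r) by
    obtain ⟨hm, hc, ht⟩ := hmain
    refine ⟨hm, hc, ?_, ?_⟩
    · intro r hr
      rcases List.mem_append.mp hr with h1 | h1
      · rcases (hc r).mp h1 with h2 | h2
        · exact Or.inl (List.mem_append_left _ h2)
        · obtain ⟨j, hj, h3⟩ := N.tob_sent k _ r ⟨rfl, h2⟩
          exact Or.inr ⟨j, by omega, h3⟩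
      · exact (ht r h1).imp_left (List.mem_append_right _)
    · intro r hr
      cases hm with
      | idle h1 => exact Or.inl (h1.state ▸ hr)
      | insert s _ _ _ h1 => exact Or.inl (h1.state ▸ hr)
      | commit s T _ _ _ h1 => exact Or.inl (h1.state ▸ hr)
      | rollback s _ hs =>
        rw [hs] at hr
        exact Or.inl (List.mem_of_mem_filter hr)
      | execute s _ hb _ hs =>
        rw [hs] at hr
        rcases List.mem_append.mp hr with h1 | h1
        · exact Or.inl h1
        · rw [List.mem_singleton.mp h1, ← hσ.order_eq, hb]
          exact Or.inr (by simp)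
  match ha : (G.event k).act with
  | Action.invoke c op l =>
    have h1 := G.invoke_eq ha
    cases l with
    | strong =>
      rw [invokeStep_strong] at h1
      rw [h1.1]
      exact ⟨Move.idle (Reorder.idle hσ rfl rfl rfl rfl rfl rfl), by simp, fun r hr => Or.inl hr⟩
    | weak =>
      by_cases hro : S.dataType.ReadOnly op
      · rw [invokeStep_readOnly _ _ _ hro] at h1
        rw [h1.1]
        exact ⟨Move.idle (Reorder.idle hσ rfl rfl rfl rfl rfl rfl), by simp, fun r hr => Or.inl hr⟩
      · rw [invokeStep_weak _ _ _ hro] at h1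
        set r := newRequest (G.event k).rep (G.event k).clock op Level.weak (G.before k) with hr
        have hsent : (G.out k).tobcast = some r := by rw [h1.2]
        obtain ⟨hn1, hn2⟩ := h.notMem_of_new hsent (R := (G.event k).rep)
        have hst : StateObject.rollback ((G.before k).state ++ [r]) r = (G.before k).state := by
          unfold StateObject.rollback
          rw [List.filter_append, List.filter_eq_self.mpr]
          · simp
          · intro x hx
            simpa using fun e => hn2 x hx (congrArg Req.dot e)
        have hd : ∀ x ∈ (G.before k).tentative, x.dot = r.dot → x = r := fun x hx e =>
          absurd e (hn1 x (List.mem_append_right _ hx))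
        rw [h1.1]
        refine ⟨Move.of_insertIntoTentative hσ rfl rfl hst rfl rfl rfl hd
          fun hx => hn1 r (List.mem_append_left _ hx) rfl, ?_, ?_⟩
        · simp [insertIntoTentative, adjustExecution]
        · intro x hx
          rcases (mem_sortedInsert hd x).mp hx with h2 | rfl
          · exact Or.inl h2
          · exact Or.inr ⟨k, by omega, hsent⟩
  | Action.rbDeliver r =>
    rw [← (G.rbDeliver_eq ha).1]
    unfold rbDeliverStep
    have hidle : Move (G.before k) (G.before k) :=
      Move.idle (Reorder.idle hσ rfl rfl rfl rfl rfl rfl)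
    by_cases h1 : r.dot.1 = (G.event k).rep
    · rw [if_pos h1]
      exact ⟨hidle, by simp, fun r hr => Or.inl hr⟩
    rw [if_neg h1]
    by_cases h2 : r ∈ (G.before k).committed
    · rw [if_neg (not_not.mpr h2)]
      exact ⟨hidle, by simp, fun r hr => Or.inl hr⟩
    rw [if_pos h2]
    obtain ⟨j, hj, h3⟩ := N.rb_sent k _ r ⟨rfl, ha⟩
    obtain ⟨h4, h5⟩ := G.rbcast_eq_some h3
    have hd : ∀ x ∈ (G.before k).tentative, x.dot = r.dot → x = r := fun x hx e =>
      Trajectory.IssuedBefore.eq_of_dot_eq _ (h.issued _ x (List.mem_append_right _ hx))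
        ⟨j, hj, h4⟩ e
    refine ⟨Move.of_insertIntoTentative hσ rfl rfl rfl rfl rfl h5 hd h2, ?_, ?_⟩
    · simp [insertIntoTentative, adjustExecution]
    · intro x hx
      rcases (mem_sortedInsert hd x).mp hx with h6 | rfl
      · exact Or.inl h6
      · exact Or.inr ⟨j, by omega, h4⟩
  | Action.tobDeliver r =>
    have hr : r ∉ (G.before k).committed := by
      intro hr
      obtain ⟨j, hj, h1⟩ := (h.mem_committed _ r).mp hr
      exact hj.ne (N.tob_once j k _ r h1 ⟨rfl, ha⟩)
    obtain ⟨h1, h2⟩ := Move.of_commit hσ hr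
    rw [← (G.tobDeliver_eq ha).1] at h1 h2
    refine ⟨h1, ?_, ?_⟩
    · intro x
      rw [h2]
      simp [eq_comm]
    · intro x hx
      have h3 := (commit_fields (G.before k) r).2.1
      rw [← (G.tobDeliver_eq ha).1] at h3
      exact Or.inl (h3 hx)
  | Action.rollback =>
    obtain ⟨h1, h2, _⟩ := Move.of_rollbackStep (G.rollback_eq ha).1
    refine ⟨h1, by simp [h2], ?_⟩
    have h3 := (G.rollback_eq ha).1
    unfold rollbackStep at h3
    split at h3
    · cases h3
    · rw [← Option.some.inj h3]
      exact fun x hx => Or.inl hx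
  | Action.execute =>
    have h3 := G.execute_eq ha
    obtain ⟨h1, h2, _⟩ := Move.of_executeStep h3
    refine ⟨h1, by simp [h2], ?_⟩
    rw [(executeStep_fields h3).2.1]
    exact fun x hx => Or.inl hx

theorem invariant (N : G.NetworkGuarantees) (k : ℕ) : G.Invariant k := by
  induction k with
  | zero =>
    constructor
    · intro R
      rw [G.config_zero]
      exact RState.consistent_initial
    all_goals
      intro R r
      rw [G.config_zero]
      simp [RState.initial, RState.order]
  | succ k ih =>
    obtain ⟨h1, h2, h3, h4⟩ := ih.move_after N
    constructor
    · intro R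
      by_cases hR : R = (G.event k).rep
      · subst hR
        exact h1.consistent (ih.consistent _)
      · rw [G.config_other k R hR]
        exact ih.consistent R
    · intro R r hr
      by_cases hR : R = (G.event k).rep
      · subst hR
        rcases h3 r hr with h5 | h5
        · exact (ih.issued _ r h5).mono (Nat.le_succ k)
        · exact h5
      · rw [G.config_other k R hR] at hr
        exact (ih.issued R r hr).mono (Nat.le_succ k)
    · intro R r hr
      by_cases hR : R = (G.event k).rep
      · subst hR
        rcases h4 r hr with h5 | h5
        · exact (ih.issued_state _ r h5).mono (Nat.le_succ k)
        · exact (ih.issued _ r h5).mono (Nat.le_succ k)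
      · rw [G.config_other k R hR] at hr
        exact (ih.issued_state R r hr).mono (Nat.le_succ k)
    · intro R r
      have hsplit : (∃ j, j < k + 1 ∧ G.Occurs j R (Action.tobDeliver r)) ↔
          (∃ j, j < k ∧ G.Occurs j R (Action.tobDeliver r)) ∨
            G.Occurs k R (Action.tobDeliver r) := by
        constructor
        · rintro ⟨j, hj, h⟩
          rcases Nat.lt_succ_iff_lt_or_eq.mp hj with h5 | rfl
          · exact Or.inl ⟨j, h5, h⟩
          · exact Or.inr h
        · rintro (⟨j, hj, h⟩ | h)
          · exact ⟨j, by omega, h⟩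
          · exact ⟨k, by omega, h⟩
      rw [hsplit, ← ih.mem_committed]
      by_cases hR : R = (G.event k).rep
      · subst hR
        rw [show G.config (k + 1) (G.event k).rep = G.after k from rfl, h2 r]
        simp [Trajectory.Occurs, Trajectory.before]
      · rw [G.config_other k R hR]
        exact ⟨Or.inl, fun h => h.resolve_right fun h => hR h.1.symm⟩

theorem consistent (N : G.NetworkGuarantees) (k : ℕ) (R : Fin n) : (G.config k R).Consistent :=
  (invariant N k).consistent R

theorem move (N : G.NetworkGuarantees) (k : ℕ) (R : Fin n) :
    Move (G.config k R) (G.config (k + 1) R) := by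
  by_cases hR : R = (G.event k).rep
  · subst hR
    exact ((invariant N k).move_after N).1
  · rw [G.config_other k R hR]
    exact Move.idle (Reorder.idle (consistent N k R) rfl rfl rfl rfl rfl rfl)

theorem committed_prefix (N : G.NetworkGuarantees) (R : Fin n) {j k : ℕ} (h : j ≤ k) :
    (G.config j R).committed <+: (G.config k R).committed := by
  induction k, h using Nat.le_induction with
  | base => exact List.prefix_rfl
  | succ k _ ih => exact ih.trans (move N k R).committed_prefix

theorem mem_order_mono (N : G.NetworkGuarantees) (R : Fin n) {j k : ℕ} (h : j ≤ k) {r : Req n Op}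
    (hr : r ∈ (G.config j R).order) : r ∈ (G.config k R).order := by
  induction k, h using Nat.le_induction with
  | base => exact hr
  | succ k _ ih => exact (move N k R).mem_order ih

end Execution

namespace Execution

variable {G : Execution n S}

/-! ### The order of total order broadcast -/

/-- `r` is delivered before `s` by total order broadcast. -/
def TobLt (G : Execution n S) (r s : Req n Op) : Prop :=
  ∃ R j k, j < k ∧ G.Occurs j R (Action.tobDeliver r) ∧ G.Occurs k R (Action.tobDeliver s)

theorem TobLt.delivered_left {r s : Req n Op} (h : G.TobLt r s) : G.TobDelivered r := by
  obtain ⟨R, j, k, _, h, _⟩ := h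
  exact ⟨j, R, h⟩

theorem TobLt.delivered_right {r s : Req n Op} (h : G.TobLt r s) : G.TobDelivered s := by
  obtain ⟨R, j, k, _, _, h⟩ := h
  exact ⟨k, R, h⟩

theorem TobLt.exists_lt (N : G.NetworkGuarantees) {r s : Req n Op} (h : G.TobLt r s) {k : ℕ}
    {R : Fin n} (hs : G.Occurs k R (Action.tobDeliver s)) :
    ∃ j, j < k ∧ G.Occurs j R (Action.tobDeliver r) := by
  obtain ⟨R', j, k', hjk, h1, h2⟩ := h
  exact N.tob_order R' R r s j k' k hjk h1 h2 hs

theorem TobLt.irrefl (N : G.NetworkGuarantees) (r : Req n Op) : ¬ G.TobLt r r := by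
  rintro ⟨R, j, k, hjk, h1, h2⟩
  exact hjk.ne (N.tob_once j k R r h1 h2)

theorem TobLt.asymm (N : G.NetworkGuarantees) {r s : Req n Op} (h : G.TobLt r s) :
    ¬ G.TobLt s r := by
  intro h'
  obtain ⟨R, j, k, hjk, h1, h2⟩ := h
  obtain ⟨j', hj', h3⟩ := h'.exists_lt N h1
  have := N.tob_once j' k R s h3 h2
  omega

theorem tobLt_or_tobLt (N : G.NetworkGuarantees) {r s : Req n Op} (hr : G.TobDelivered r)
    (hs : G.TobDelivered s) (hne : r ≠ s) : G.TobLt r s ∨ G.TobLt s r := by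
  obtain ⟨j, R, hj⟩ := hr
  obtain ⟨k, hk⟩ := N.tob_agreement s hs R
  rcases lt_trichotomy j k with h | rfl | h
  · exact Or.inl ⟨R, j, k, h, hj, hk⟩
  · exact absurd (Action.tobDeliver.inj (hj.2.symm.trans hk.2)) hne
  · exact Or.inr ⟨R, k, j, h, hk, hj⟩

/-- The first event by which `r` is delivered by total order broadcast at some replica; `0` if
there is none. -/
noncomputable def firstDelivery (G : Execution n S) (r : Req n Op) : ℕ :=
  sInf {k | ∃ R, G.Occurs k R (Action.tobDeliver r)}

theorem firstDelivery_spec {r : Req n Op} (h : G.TobDelivered r) :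
    ∃ R, G.Occurs (G.firstDelivery r) R (Action.tobDeliver r) :=
  Nat.sInf_mem (s := {k | ∃ R, G.Occurs k R (Action.tobDeliver r)}) h

theorem firstDelivery_le {r : Req n Op} {k : ℕ} {R : Fin n}
    (h : G.Occurs k R (Action.tobDeliver r)) : G.firstDelivery r ≤ k :=
  Nat.sInf_le ⟨R, h⟩

theorem TobLt.firstDelivery_lt (N : G.NetworkGuarantees) {r s : Req n Op} (h : G.TobLt r s) :
    G.firstDelivery r < G.firstDelivery s := by
  obtain ⟨R, hR⟩ := firstDelivery_spec h.delivered_right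
  obtain ⟨j, hj, h1⟩ := h.exists_lt N hR
  exact (firstDelivery_le h1).trans_lt hj

theorem tobLt_iff_firstDelivery_lt (N : G.NetworkGuarantees) {r s : Req n Op}
    (hr : G.TobDelivered r) (hs : G.TobDelivered s) :
    G.TobLt r s ↔ G.firstDelivery r < G.firstDelivery s := by
  refine ⟨fun h => h.firstDelivery_lt N, fun h => ?_⟩
  rcases tobLt_or_tobLt N hr hs (fun e => by simp [e] at h) with h1 | h1
  · exact h1
  · exact absurd (h1.firstDelivery_lt N) (by omega)

theorem TobDelivered.issued (N : G.NetworkGuarantees) {r : Req n Op} (h : G.TobDelivered r) :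
    ∃ j, j < G.firstDelivery r ∧ (G.out j).tobcast = some r := by
  obtain ⟨R, hR⟩ := firstDelivery_spec h
  exact N.tob_sent _ R r hR

theorem tobDelivered_of_mem_committed (N : G.NetworkGuarantees) {k : ℕ} {R : Fin n}
    {r : Req n Op} (h : r ∈ (G.config k R).committed) :
    G.TobDelivered r ∧ G.firstDelivery r < k := by
  obtain ⟨j, hj, h1⟩ := ((invariant N k).mem_committed R r).mp h
  exact ⟨⟨j, R, h1⟩, (firstDelivery_le h1).trans_lt hj⟩

theorem pairwise_committed (N : G.NetworkGuarantees) (k : ℕ) (R : Fin n) :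
    (G.config k R).committed.Pairwise G.TobLt := by
  induction k with
  | zero => simp [G.config_zero, RState.initial]
  | succ k ih =>
    rcases (move N k R).committed_eq_or with h | ⟨r, hr, h⟩
    · rwa [h]
    · rw [h, List.pairwise_append]
      refine ⟨ih, List.pairwise_singleton _ _, ?_⟩
      intro x hx y hy
      rw [List.mem_singleton.mp hy]
      obtain ⟨j, hj, h1⟩ := ((invariant N k).mem_committed R x).mp hx
      obtain ⟨j', hj', h2⟩ := ((invariant N (k + 1)).mem_committed R r).mp (h ▸ by simp)
      rcases Nat.lt_succ_iff_lt_or_eq.mp hj' with h3 | rfl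
      · exact absurd (((invariant N k).mem_committed R r).mpr ⟨j', h3, h2⟩) hr
      · exact ⟨R, j, j', hj, h1, h2⟩

/-- The requests that a replica has committed before `r` are those delivered before `r`. -/
theorem mem_iff_tobLt (N : G.NetworkGuarantees) {k : ℕ} {R : Fin n} {c d : List (Req n Op)}
    {r : Req n Op} (h : (G.config k R).committed = c ++ r :: d) (x : Req n Op) :
    x ∈ c ↔ G.TobLt x r := by
  have hp := pairwise_committed N k R
  rw [h, List.pairwise_append] at hp
  constructor
  · exact fun hx => hp.2.2 x hx r (by simp)
  · intro hx
    obtain ⟨j, hj, h1⟩ := ((invariant N k).mem_committed R r).mp (h ▸ by simp)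
    obtain ⟨j', hj', h2⟩ := hx.exists_lt N h1
    have hm := ((invariant N k).mem_committed R x).mpr ⟨j', by omega, h2⟩
    rw [h] at hm
    rcases List.mem_append.mp hm with h3 | h3
    · exact h3
    · rcases List.mem_cons.mp h3 with rfl | h3
      · exact absurd hx (TobLt.irrefl N _)
      · exact absurd ((List.pairwise_cons.mp hp.2.1).1 x h3) (hx.asymm N)

/-! ### Progress -/

open Filter

/-- A prefix of the intended order of a replica that does not change any more is eventually
executed: if it were not, the list of executed requests would be frozen at a shorter prefix, so
only finitely many rollbacks would remain and fairness would force a further execution. -/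
theorem eventually_prefix_executed (N : G.NetworkGuarantees) (F : G.Fair) (R : Fin n)
    {p : List (Req n Op)} (hp : ∀ᶠ k in atTop, p <+: (G.config k R).order) :
    ∀ᶠ k in atTop, p <+: (G.config k R).executed := by
  suffices h : ∀ a, ∀ᶠ k in atTop, p.take a <+: (G.config k R).executed by
    simpa using h p.length
  intro a
  induction a with
  | zero => simp
  | succ a ih =>
    obtain ⟨T, hT⟩ := eventually_atTop.mp (hp.and ih)
    by_contra hcon
    have hno : ∀ k, T ≤ k → ¬ p.take (a + 1) <+: (G.config k R).executed := by
      intro k hk hpre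
      refine hcon (eventually_atTop.mpr ⟨k, fun m hm => ?_⟩)
      induction m, hm using Nat.le_induction with
      | base => exact hpre
      | succ m hm ih' =>
        exact (move N m R).prefix_executed ih'
          ((List.take_prefix _ _).trans (hT (m + 1) (by omega)).1)
    have hE : ∀ k, T ≤ k → (G.config k R).executed = p.take a := by
      intro k hk
      obtain ⟨h1, h2⟩ := hT k hk
      have h3 : p.take (a + 1) <+: (G.config k R).order := (List.take_prefix _ _).trans h1
      rcases List.prefix_or_prefix_of_prefix (consistent N k R).executed_prefix h3 with h4 | h4
      · refine (h2.eq_of_length_le ?_).symm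
        by_contra hlt
        refine hno k hk ?_
        have h5 := h4.length_le
        have h6 := h2.length_le
        simp only [List.length_take] at *
        rw [h4.eq_of_length_le (by simp only [List.length_take]; omega)]
      · exact absurd h4 (hno k hk)
    -- From `k₀` on, the number of requests to be rolled back does not change.
    obtain ⟨k₀, hk₀, hmin⟩ : ∃ k₀, T ≤ k₀ ∧ ∀ k, T ≤ k →
        (G.config k₀ R).toBeRolledBack.length ≤ (G.config k R).toBeRolledBack.length := by
      obtain ⟨k₀, hk₀, h1⟩ := Nat.sInf_mem
        (s := (fun k => (G.config k R).toBeRolledBack.length) '' Set.Ici T) ⟨_, T, Set.mem_Ici.mpr le_rfl, rfl⟩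
      exact ⟨k₀, hk₀, fun k hk => h1.trans_le (Nat.sInf_le ⟨k, hk, rfl⟩)⟩
    have hle : ∀ k, k₀ ≤ k →
        (G.config k R).toBeRolledBack.length ≤ (G.config k₀ R).toBeRolledBack.length := by
      intro k hk
      induction k, hk using Nat.le_induction with
      | base => exact le_rfl
      | succ k hk ih' =>
        exact ((move N k R).length_toBeRolledBack_le
          (by rw [hE k (by omega), hE (k + 1) (by omega)])).trans ih'
    have hempty : ∀ k, k₀ ≤ k → (G.config k R).toBeRolledBack = [] := by
      rcases (F R).2.1 with h | h
      · obtain ⟨k, ⟨hR, hk⟩, hlt⟩ := h.exists_gt k₀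
        have h1 := (Move.of_rollbackStep (G.rollback_eq hk).1).2.2
        subst hR
        have h2 := hmin (k + 1) (by omega)
        have h3 := hle k hlt.le
        unfold Trajectory.after Trajectory.before at h1
        omega
      · obtain ⟨k, ⟨hR, hk⟩, hlt⟩ := h.exists_gt k₀
        have h1 : (G.config (k + 1) R).toBeRolledBack = [] := by
          by_contra hne
          obtain ⟨r, t, hrt⟩ := List.exists_cons_of_ne_nil hne
          exact hk ⟨0, by simp [step, rollbackStep, hrt]⟩
        have h2 := hmin (k + 1) (by omega)
        rw [h1] at h2
        intro m hm
        exact List.eq_nil_of_length_eq_zero (Nat.le_zero.mp ((hle m hm).trans h2))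
    rcases (F R).2.2 with h | h
    · obtain ⟨k, ⟨hR, hk⟩, hlt⟩ := h.exists_gt k₀
      have h1 := (Move.of_executeStep (G.execute_eq hk)).2.2.1
      subst hR
      unfold Trajectory.after Trajectory.before at h1
      rw [hE k (by omega), hE (k + 1) (by omega)] at h1
      omega
    · obtain ⟨k, ⟨hR, hk⟩, hlt⟩ := h.exists_gt k₀
      have h1 : (G.config (k + 1) R).toBeExecuted ≠ [] := by
        intro h1
        have h2 := (consistent N (k + 1) R).order_eq
        rw [h1, List.append_nil] at h2
        exact hno (k + 1) (by omega)
          (h2 ▸ (List.take_prefix _ _).trans (hT (k + 1) (by omega)).1)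
      obtain ⟨r, t, hrt⟩ := List.exists_cons_of_ne_nil h1
      refine hk ⟨0, ?_⟩
      simp only [step, executeStep, hempty (k + 1) (by omega), hrt]
      split_ifs <;> rfl

theorem finite_clock_le (F : G.Fair) (t : ℤ) : {k | (G.event k).clock ≤ t}.Finite := by
  have hcover : {k | (G.event k).clock ≤ t} =
      ⋃ R : Fin n, {k | (G.event k).rep = R ∧ (G.event k).clock ≤ t} := by
    ext k
    simp
  rw [hcover]
  refine Set.finite_iUnion fun R => ?_
  by_contra hinf
  obtain ⟨k₀, hk₀⟩ := (F R).1.nonempty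
  refine G.clock_infinite R (F R).1 ?_
  obtain ⟨b, hb⟩ : ∃ b, ∀ k, (G.event k).rep = R → b ≤ (G.event k).clock := by
    classical
    have hex : ∃ k, (G.event k).rep = R := ⟨k₀, hk₀⟩
    refine ⟨(G.event (Nat.find hex)).clock, fun k hk => ?_⟩
    rcases (Nat.find_min' hex hk).eq_or_lt with h | h
    · rw [h]
    · exact G.clock_mono _ _ h ((Nat.find_spec hex).trans hk.symm)
  refine (Set.finite_Icc b t).subset ?_
  rintro _ ⟨k, hk, rfl⟩
  obtain ⟨m, ⟨hm, hmt⟩, hlt⟩ := Set.Infinite.exists_gt hinf k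
  exact ⟨hb k hk, (G.clock_mono k m hlt (hk.trans hm.symm)).trans hmt⟩

/-! ### Arbitration of requests -/

/-- The request `r` occurs in the run and is not a strong one that stays undelivered forever. These
are the requests that can be executed. -/
def Effective (G : Execution n S) (r : Req n Op) : Prop :=
  (∃ k, (G.out k).tobcast = some r) ∧ (r.lvl = Level.weak ∨ G.TobDelivered r)

/-- The final order of requests: first the delivered ones in the order of total order broadcast,
then the others in the order of their timestamps and dots. -/
def ReqLt (G : Execution n S) (r s : Req n Op) : Prop :=
  G.TobLt r s ∨ (G.TobDelivered r ∧ ¬ G.TobDelivered s) ∨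
    (¬ G.TobDelivered r ∧ ¬ G.TobDelivered s ∧ r.Before s)

theorem effective_of_mem_order (N : G.NetworkGuarantees) {k : ℕ} {R : Fin n} {r : Req n Op}
    (h : r ∈ (G.config k R).order) : G.Effective r := by
  obtain ⟨j, _, hj⟩ := (invariant N k).issued R r h
  refine ⟨⟨j, hj⟩, ?_⟩
  rcases List.mem_append.mp h with h | h
  · exact Or.inr (tobDelivered_of_mem_committed N h).1
  · exact Or.inl ((consistent N k R).weak_of_tentative r h)

theorem effective_of_mem_state (N : G.NetworkGuarantees) {k : ℕ} {R : Fin n} {r : Req n Op}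
    (h : r ∈ (G.config k R).state) : G.Effective r := by
  obtain ⟨j, _, hj⟩ := (invariant N k).issued_state R r h
  refine ⟨⟨j, hj⟩, ?_⟩
  cases hl : r.lvl with
  | weak => exact Or.inl rfl
  | strong =>
    exact Or.inr (tobDelivered_of_mem_committed N ((consistent N k R).of_strong r h hl).2).1

/-- Every effective request eventually enters the intended order of every replica. -/
theorem eventually_mem_order (N : G.NetworkGuarantees) {r : Req n Op} (hr : G.Effective r)
    (R : Fin n) : ∀ᶠ k in atTop, r ∈ (G.config k R).order := by
  suffices h : ∃ k, r ∈ (G.config k R).order by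
    obtain ⟨k, hk⟩ := h
    exact eventually_atTop.mpr ⟨k, fun m hm => mem_order_mono N R hm hk⟩
  by_cases hd : G.TobDelivered r
  · obtain ⟨k, hk⟩ := N.tob_agreement r hd R
    exact ⟨k + 1, List.mem_append_left _
      (((invariant N (k + 1)).mem_committed R r).mpr ⟨k, by omega, hk⟩)⟩
  have hw := hr.2.resolve_right hd
  obtain ⟨j, hj⟩ := hr.1
  by_cases hR : (G.event j).rep = R
  · obtain ⟨c, op, l, ha, hl, hrj, _⟩ := G.tobcast_eq_some hj
    obtain rfl : l = Level.weak := by rw [hrj] at hw; exact hw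
    have h1 := (G.invoke_eq ha).1
    rw [invokeStep_weak _ _ _ fun h => hl ⟨rfl, h⟩, ← hrj] at h1
    refine ⟨j + 1, List.mem_append_right _ ?_⟩
    rw [← hR, show G.config (j + 1) (G.event j).rep = G.after j from rfl, h1]
    change r ∈ sortedInsert _ r
    simp [sortedInsert]
  · obtain ⟨k, hk⟩ := N.rb_delivered j r (G.rbcast_of_weak hj hw) R
    have h1 := (G.rbDeliver_eq hk.2).1
    have hdot : r.dot.1 ≠ (G.event k).rep := by
      obtain ⟨_, _, _, _, _, hrj, _⟩ := G.tobcast_eq_some hj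
      rw [hrj, hk.1]
      exact hR
    have h2 : r ∉ (G.before k).committed := fun h2 => hd (tobDelivered_of_mem_committed N h2).1
    unfold rbDeliverStep at h1
    rw [if_neg hdot, if_pos h2] at h1
    refine ⟨k + 1, List.mem_append_right _ ?_⟩
    rw [← hk.1, show G.config (k + 1) (G.event k).rep = G.after k from rfl, ← h1]
    change r ∈ sortedInsert _ r
    simp [sortedInsert]

/-- In an asynchronous run, the intended order of every replica eventually starts with the
effective requests up to `r`, in their final order. -/
theorem exists_eventually_prefix_order (A : G.IsAsynchronousRun) {r : Req n Op}
    (hr : G.Effective r) (R : Fin n) :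
    ∃ q : List (Req n Op), (∀ x, x ∈ q ↔ G.Effective x ∧ G.ReqLt x r) ∧
      ∀ᶠ k in atTop, q ++ [r] <+: (G.config k R).order := by
  classical
  have N := A.network
  by_cases hd : G.TobDelivered r
  · obtain ⟨k, hk⟩ := N.tob_agreement r hd R
    obtain ⟨c, d, hcd⟩ := List.append_of_mem
      (((invariant N (k + 1)).mem_committed R r).mpr ⟨k, by omega, hk⟩)
    refine ⟨c, fun x => ?_, eventually_atTop.mpr ⟨k + 1, fun m hm => ?_⟩⟩
    · rw [mem_iff_tobLt N hcd]
      constructor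
      · intro h
        obtain ⟨j, _, hj⟩ := TobDelivered.issued N h.delivered_left
        exact ⟨⟨⟨j, hj⟩, Or.inr h.delivered_left⟩, Or.inl h⟩
      · rintro ⟨_, h | h | h⟩
        · exact h
        · exact absurd hd h.2
        · exact absurd hd h.2.1
    · refine List.IsPrefix.trans ?_ ((committed_prefix N R hm).trans (List.prefix_append _ _))
      exact ⟨d, by rw [hcd]; simp⟩
  -- Only finitely many requests are delivered, since `r` is not.
  have hfin : {s | G.TobDelivered s}.Finite := by
    by_contra hinf
    obtain ⟨j, hj⟩ := hr.1
    exact hd (A.tob_no_starvation hinf j r hj)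
  set B : Set (Req n Op) := {x | (G.Effective x ∧ ¬ G.TobDelivered x) ∧ x.Before r} with hB
  have hBfin : B.Finite := by
    refine Set.Finite.subset ((finite_clock_le A.fair r.timestamp).biUnion
      (t := fun k => {x | (G.out k).tobcast = some x}) fun k _ => ?_) ?_
    · exact Set.Subsingleton.finite fun x hx y hy => Option.some.inj (hx.symm.trans hy)
    · rintro x ⟨⟨⟨⟨j, hj⟩, _⟩, _⟩, hx⟩
      refine Set.mem_biUnion (x := j) ?_ hj
      obtain ⟨_, _, _, _, _, hxj, _⟩ := G.tobcast_eq_some hj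
      have : x.timestamp = (G.event j).clock := by rw [hxj]; rfl
      rw [Set.mem_ofPred_eq, ← this]
      rcases hx with hx | hx
      · exact hx.le
      · exact hx.1.le
  have hC : ∀ᶠ k in atTop, ∀ s ∈ {s | G.TobDelivered s}, s ∈ (G.config k R).committed := by
    refine hfin.eventually_all.mpr fun s hs => ?_
    obtain ⟨k, hk⟩ := N.tob_agreement s hs R
    exact eventually_atTop.mpr ⟨k + 1, fun m hm =>
      ((invariant N m).mem_committed R s).mpr ⟨k, by omega, hk⟩⟩
  have hall : ∀ᶠ k in atTop, ∀ x ∈ B, x ∈ (G.config k R).order :=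
    hBfin.eventually_all.mpr fun x hx => eventually_mem_order N hx.1.1 R
  obtain ⟨T, hT⟩ := eventually_atTop.mp ((hC.and hall).and (eventually_mem_order N hr R))
  -- From `T` on, the committed list and the tentative requests before `r` do not change.
  have hcm : ∀ k, T ≤ k → ∀ x, x ∈ (G.config k R).committed ↔ G.TobDelivered x :=
    fun k hk x => ⟨fun h => (tobDelivered_of_mem_committed N h).1, (hT k hk).1.1 x⟩
  have htm : ∀ k, T ≤ k → ∀ x ∈ (G.config k R).order, ¬ G.TobDelivered x →
      x ∈ (G.config k R).tentative := fun k hk x hx hnd =>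
    (List.mem_append.mp hx).resolve_left fun h => hnd ((hcm k hk x).mp h)
  set f : ℕ → List (Req n Op) := fun k =>
    (G.config k R).tentative.filter (fun x => x.Before r) with hf
  have hfm : ∀ k, T ≤ k → ∀ x, x ∈ f k ↔ x ∈ B := by
    intro k hk x
    simp only [hf, List.mem_filter, decide_eq_true_eq, hB, Set.mem_ofPred_eq]
    refine and_congr_left fun hx => ⟨fun h => ?_, fun h => htm k hk x ((hT k hk).1.2 x ⟨h, hx⟩) h.2⟩
    refine ⟨effective_of_mem_order N (List.mem_append_right _ h), fun h1 => ?_⟩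
    exact (List.nodup_append.mp (consistent N k R).nodup_order).2.2 x ((hcm k hk x).mpr h1) x h rfl
  have hceq : ∀ k, T ≤ k → (G.config k R).committed = (G.config T R).committed := fun k hk =>
    eq_of_pairwise_of_mem_iff (TobLt.irrefl N) (fun _ _ => TobLt.asymm N)
      (pairwise_committed N k R) (pairwise_committed N T R)
      fun x => (hcm k hk x).trans (hcm T le_rfl x).symm
  have hfeq : ∀ k, T ≤ k → f k = f T := fun k hk =>
    eq_of_pairwise_of_mem_iff Req.Before.irrefl (fun _ _ => Req.Before.asymm)
      ((consistent N k R).sorted.filter _) ((consistent N T R).sorted.filter _)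
      fun x => (hfm k hk x).trans (hfm T le_rfl x).symm
  refine ⟨(G.config T R).committed ++ f T, fun x => ?_, eventually_atTop.mpr ⟨T, fun k hk => ?_⟩⟩
  · rw [List.mem_append, hcm T le_rfl, hfm T le_rfl]
    constructor
    · rintro (h | h)
      · obtain ⟨j, _, hj⟩ := TobDelivered.issued N h
        exact ⟨⟨⟨j, hj⟩, Or.inr h⟩, Or.inr (Or.inl ⟨h, hd⟩)⟩
      · exact ⟨h.1.1, Or.inr (Or.inr ⟨h.1.2, hd, h.2⟩)⟩
    · rintro ⟨h1, h2 | h2 | h2⟩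
      · exact absurd h2.delivered_right hd
      · exact Or.inl h2.1
      · exact Or.inr ⟨⟨h1, h2.1⟩, h2.2.2⟩
  · have hrt := htm k hk r (hT k hk).2 hd
    have hsort := (consistent N k R).sorted
    obtain ⟨a, b, hab⟩ := List.append_of_mem hrt
    rw [hab, List.pairwise_append, List.pairwise_cons] at hsort
    have hfa : f k = a := by
      simp only [hf, hab]
      rw [List.filter_append, List.filter_eq_self.mpr, List.filter_eq_nil_iff.mpr,
        List.append_nil]
      · intro x hx
        rcases List.mem_cons.mp hx with rfl | hx
        · simpa using Req.Before.irrefl x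
        · simpa using (hsort.2.1.1 x hx).asymm
      · intro x hx
        simpa using hsort.2.2 x hx r (by simp)
    rw [← hceq k hk, ← hfeq k hk, hfa, RState.order, hab]
    exact ⟨b, by simp⟩

/-- Every effective request `r` is eventually in the trace of every replica, preceded exactly by
the effective requests before `r` in the final order. -/
theorem exists_eventually_prefix_state (A : G.IsAsynchronousRun) {r : Req n Op}
    (hr : G.Effective r) (R : Fin n) :
    ∃ q : List (Req n Op), (∀ x, x ∈ q ↔ G.Effective x ∧ G.ReqLt x r) ∧
      ∀ᶠ k in atTop, q ++ [r] <+: (G.config k R).state := by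
  obtain ⟨q, hq, h⟩ := exists_eventually_prefix_order A hr R
  refine ⟨q, hq, (eventually_prefix_executed A.network A.fair R h).mono fun k hk => ?_⟩
  exact hk.trans (consistent A.network k R).executed_prefix_state

end Execution

namespace Execution

variable (G : Execution n S)

/-! ### Invocations and their responses -/

/-- The request issued by an invocation; `none` for weak read-only operations. -/
def req (e : G.Inv) : Option (Req n Op) := (G.out e).tobcast

/-- The trace of the state object on which the operation `e` is invoked. -/
def traceAt (e : G.Inv) : List (Req n Op) := (G.before e).state

/-- The level of an invocation. -/
def lvlOf (e : G.Inv) : Level := (G.invData e).2.2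

/-- The operation of an invocation. -/
def opOf (e : G.Inv) : Op := (G.invData e).2.1

variable {G}

theorem act_invoke (e : G.Inv) :
    (G.event e).act = Action.invoke (G.invData e).1 (G.opOf e) (G.lvlOf e) := G.act_eq e

theorem readOnly_of_req_eq_none {e : G.Inv} (h : G.req e = none) :
    G.lvlOf e = Level.weak ∧ S.dataType.ReadOnly (G.opOf e) := by
  have h1 := (G.invoke_eq (act_invoke e)).2
  cases hl : G.lvlOf e with
  | weak =>
    refine ⟨rfl, ?_⟩
    by_contra hro
    rw [hl, invokeStep_weak _ _ _ hro] at h1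
    rw [req, h1] at h
    cases h
  | strong =>
    rw [hl, invokeStep_strong] at h1
    rw [req, h1] at h
    cases h

theorem req_eq {e : G.Inv} {r : Req n Op} (h : G.req e = some r) :
    r = newRequest (G.event e).rep (G.event e).clock (G.opOf e) (G.lvlOf e) (G.before e) := by
  obtain ⟨c, op, l, ha, _, hr, _⟩ := G.tobcast_eq_some h
  obtain ⟨_, h2, h3⟩ := Action.invoke.inj ((act_invoke e).symm.trans ha)
  rw [hr, h2, h3]

theorem lvl_of_req {e : G.Inv} {r : Req n Op} (h : G.req e = some r) : r.lvl = G.lvlOf e := by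
  rw [req_eq h]
  rfl

theorem op_of_req {e : G.Inv} {r : Req n Op} (h : G.req e = some r) : r.op = G.opOf e := by
  rw [req_eq h]
  rfl

theorem req_injective {e f : G.Inv} {r : Req n Op} (he : G.req e = some r)
    (hf : G.req f = some r) : e = f :=
  Subtype.ext (G.eq_of_dot_eq he hf rfl)

theorem exists_req_eq {k : ℕ} {r : Req n Op} (h : (G.out k).tobcast = some r) :
    ∃ e : G.Inv, (e : ℕ) = k ∧ G.req e = some r := by
  obtain ⟨c, op, l, ha, _⟩ := G.tobcast_eq_some h
  exact ⟨⟨k, by rw [ha]; rfl⟩, rfl, h⟩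

/-- The field `ctx` of a request records the trace on which its operation was invoked. -/
theorem dot_mem_ctx_iff (N : G.NetworkGuarantees) {e : G.Inv} {r : Req n Op}
    (h : G.req e = some r) {s : Req n Op} (hs : ∃ k, (G.out k).tobcast = some s) :
    s.dot ∈ r.ctx ↔ s ∈ G.traceAt e := by
  have hσ : (G.before e).Consistent := consistent N e _
  have hctx : s.dot ∈ r.ctx ↔ ∃ x ∈ G.traceAt e, x.dot = s.dot := by
    rw [req_eq h]
    simp only [newRequest, traceAt, hσ.state_eq, Finset.mem_union, List.mem_toFinset,
      List.mem_map, List.mem_append, List.mem_reverse]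
    constructor
    · rintro (⟨x, hx, hd⟩ | ⟨x, hx, hd⟩)
      · exact ⟨x, Or.inl hx, hd⟩
      · exact ⟨x, Or.inr hx, hd⟩
    · rintro ⟨x, hx | hx, hd⟩
      · exact Or.inl ⟨x, hx, hd⟩
      · exact Or.inr ⟨x, hx, hd⟩
  rw [hctx]
  constructor
  · rintro ⟨x, hx, hd⟩
    obtain ⟨k, hk⟩ := hs
    have h1 := (invariant N e).issued_state _ x hx
    rwa [← Trajectory.IssuedBefore.eq_of_dot_eq _ h1 ⟨k, Nat.lt_succ_self k, hk⟩ hd]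
  · exact fun hx => ⟨s, hx, rfl⟩

theorem response_of_weak {e : G.Inv} (h : G.lvlOf e = Level.weak) :
    G.response e = some (S.dataType.F (G.opOf e) (traceContext (G.traceAt e))) := by
  classical
  have h1 := (G.invoke_eq (act_invoke e)).2
  have h2 : (G.out e).returned =
      some (S.dataType.F (G.opOf e) (traceContext (G.traceAt e))) := by
    rw [h1, h]
    by_cases hro : S.dataType.ReadOnly (G.opOf e)
    · rw [invokeStep_readOnly _ _ _ hro]
      rfl
    · rw [invokeStep_weak _ _ _ hro]
      rfl
  have h3 : G.respAt e e =
      some (S.dataType.F (G.opOf e) (traceContext (G.traceAt e))) := by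
    rw [Trajectory.respAt, if_pos rfl, h2]
  have hex : ∃ j, (G.respAt e j).isSome := ⟨e, by rw [h3]; rfl⟩
  have hfind : Nat.find hex = e :=
    le_antisymm (Nat.find_min' hex (by rw [h3]; rfl)) (G.le_of_respAt (Nat.find_spec hex))
  rw [Trajectory.response, dif_pos hex, hfind, h3]

theorem lvl_or_delivered_of_answered (N : G.NetworkGuarantees) {k : ℕ} {r : Req n Op} {v : Val}
    (h : (G.out k).answered = some (r, v)) :
    r.lvl = Level.weak ∨ (G.TobDelivered r ∧ G.firstDelivery r ≤ k) := by
  match ha : (G.event k).act with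
  | Action.invoke c op l =>
    have h1 := (G.invoke_eq ha).2
    cases l with
    | strong =>
      rw [invokeStep_strong] at h1
      rw [h1] at h
      cases h
    | weak =>
      by_cases hro : S.dataType.ReadOnly op
      · rw [invokeStep_readOnly _ _ _ hro] at h1
        rw [h1] at h
        cases h
      · rw [invokeStep_weak _ _ _ hro] at h1
        rw [h1] at h
        cases h
  | Action.rbDeliver s =>
    rw [(G.rbDeliver_eq ha).2] at h
    cases h
  | Action.tobDeliver s =>
    rw [(G.tobDeliver_eq ha).2] at h
    obtain rfl := (commit_output _ s).2 r v h
    exact Or.inr ⟨⟨k, _, rfl, ha⟩, firstDelivery_le ⟨rfl, ha⟩⟩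
  | Action.rollback =>
    rw [(G.rollback_eq ha).2] at h
    cases h
  | Action.execute =>
    refine ((Move.of_executeStep (G.execute_eq ha)).2.2.2.2 r v h).imp_right fun hr => ?_
    have := tobDelivered_of_mem_committed N hr
    exact ⟨this.1, this.2.le⟩

/-- A strong operation returns only after its request has been delivered by total order
broadcast. -/
theorem delivered_of_returnsBefore (N : G.NetworkGuarantees) {e : G.Inv} {r : Req n Op}
    (he : G.req e = some r) (hl : G.lvlOf e = Level.strong) {m : ℕ} (h : G.ReturnsBefore e m) :
    G.TobDelivered r ∧ G.firstDelivery r < m := by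
  obtain ⟨j, hj, h⟩ := h
  unfold Trajectory.respAt at h
  split_ifs at h with h1 h2
  · have h3 := (G.invoke_eq (act_invoke e)).2
    rw [hl, invokeStep_strong] at h3
    rw [h3] at h
    cases h
  · rw [show (G.out e).tobcast = some r from he] at h
    cases ha : (G.out j).answered with
    | none =>
      rw [ha] at h
      cases h
    | some p =>
      obtain ⟨s, v⟩ := p
      rw [ha] at h
      simp only at h
      split_ifs at h with h3
      · subst h3
        rcases lvl_or_delivered_of_answered N ha with h4 | h4
        · rw [lvl_of_req he, hl] at h4
          cases h4
        · exact ⟨h4.1, h4.2.trans_lt hj⟩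
      · cases h
  · cases h

theorem lt_of_returnsBefore {k m : ℕ} (h : G.ReturnsBefore k m) : k < m := by
  obtain ⟨j, hj, h⟩ := h
  exact (G.le_of_respAt h).trans_lt hj

/-! ### Visibility -/

variable (G) in
/-- Visibility: a weak operation sees the requests in the trace on which it was invoked and the
read-only operations invoked earlier, a strong one sees the requests delivered before its own. -/
def Sees (x y : G.Inv) : Prop :=
  (G.lvlOf y = Level.weak ∧
    ((∃ r, G.req x = some r ∧ r ∈ G.traceAt y) ∨ (G.req x = none ∧ (x : ℕ) < y))) ∨
  (G.lvlOf y = Level.strong ∧ ∃ r s, G.req x = some r ∧ G.req y = some s ∧ G.TobLt r s)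

theorem sees_iff_mem_traceAt {x y : G.Inv} {r : Req n Op} (hy : G.lvlOf y = Level.weak)
    (hx : G.req x = some r) : G.Sees x y ↔ r ∈ G.traceAt y := by
  simp [Sees, hy, hx]

open Classical in
variable (G) in
/-- The time at which an operation takes effect: the first delivery of its request for a strong
operation that is ever delivered, and its invocation otherwise. All causal dependencies point
forward in this time. -/
noncomputable def effectTime (e : G.Inv) : ℕ :=
  match G.req e with
  | some r => if r.lvl = Level.strong ∧ G.TobDelivered r then G.firstDelivery r else e
  | none => e

theorem effectTime_of_weak {e : G.Inv} (h : G.lvlOf e = Level.weak) : G.effectTime e = e := by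
  unfold effectTime
  split
  · rename_i r hr
    rw [if_neg]
    rintro ⟨h1, _⟩
    rw [lvl_of_req hr, h] at h1
    cases h1
  · rfl

theorem effectTime_of_delivered {e : G.Inv} {r : Req n Op} (h : G.req e = some r)
    (hl : G.lvlOf e = Level.strong) (hd : G.TobDelivered r) :
    G.effectTime e = G.firstDelivery r := by
  simp [effectTime, h, lvl_of_req h, hl, hd]

theorem lt_firstDelivery (N : G.NetworkGuarantees) {e : G.Inv} {r : Req n Op}
    (h : G.req e = some r) (hd : G.TobDelivered r) : (e : ℕ) < G.firstDelivery r := by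
  obtain ⟨j, hj, hr⟩ := TobDelivered.issued N hd
  rwa [G.eq_of_dot_eq (j := e) (k := j) h hr rfl]

theorem le_effectTime (N : G.NetworkGuarantees) (e : G.Inv) : (e : ℕ) ≤ G.effectTime e := by
  unfold effectTime
  split
  · rename_i r hr
    split_ifs with h
    · exact (lt_firstDelivery N hr h.2).le
    · exact le_rfl
  · exact le_rfl

theorem Sees.effectTime_lt (N : G.NetworkGuarantees) {x y : G.Inv} (h : G.Sees x y) :
    G.effectTime x < G.effectTime y := by
  rcases h with ⟨hy, ⟨r, hr, hm⟩ | ⟨hr, hlt⟩⟩ | ⟨hy, r, s, hr, hs, hrs⟩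
  · rw [effectTime_of_weak hy]
    cases hx : G.lvlOf x with
    | weak =>
      rw [effectTime_of_weak hx]
      obtain ⟨j, hj, hjr⟩ := (invariant N y).issued_state _ r hm
      rwa [G.eq_of_dot_eq (j := x) (k := j) hr hjr rfl]
    | strong =>
      have h1 := tobDelivered_of_mem_committed N
        ((consistent N y _).of_strong r hm ((lvl_of_req hr).trans hx)).2
      rw [effectTime_of_delivered hr hx h1.1]
      exact h1.2
  · rwa [effectTime_of_weak hy, effectTime_of_weak (readOnly_of_req_eq_none hr).1]
  · rw [effectTime_of_delivered hs hy hrs.delivered_right]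
    have h1 := hrs.firstDelivery_lt N
    cases hx : G.lvlOf x with
    | weak =>
      rw [effectTime_of_weak hx]
      exact (lt_firstDelivery N hr hrs.delivered_left).trans h1
    | strong => rwa [effectTime_of_delivered hr hx hrs.delivered_left]

theorem effectTime_lt_of_returnsBefore (N : G.NetworkGuarantees) {x y : G.Inv}
    (h : G.ReturnsBefore x y) : G.effectTime x < G.effectTime y := by
  refine lt_of_lt_of_le ?_ (le_effectTime N y)
  cases hx : G.lvlOf x with
  | weak =>
    rw [effectTime_of_weak hx]
    exact lt_of_returnsBefore h
  | strong =>
    cases hr : G.req x with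
    | none =>
      have := (readOnly_of_req_eq_none hr).1
      rw [hx] at this
      cases this
    | some r =>
      have h1 := delivered_of_returnsBefore N hr hx h
      rw [effectTime_of_delivered hr hx h1.1]
      exact h1.2

/-! ### Arbitration -/

section Arbitration

open Classical

variable (G)

/-- The position of an invocation in the coarsest level of the arbitration order: delivered
requests, other requests, read-only operations. -/
noncomputable def arClass (e : G.Inv) : ℕ :=
  match G.req e with
  | some r => if G.TobDelivered r then 0 else 1
  | none => 2

/-- The first delivery of the request of `e`; `0` if there is none. -/
noncomputable def arDelivery (e : G.Inv) : ℕ := (G.req e).elim 0 G.firstDelivery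

/-- The timestamp of the request of `e`; `0` if there is none. -/
def arStamp (e : G.Inv) : ℤ := (G.req e).elim 0 Req.timestamp

/-- The replica issuing the request of `e`; `0` if there is none. -/
def arReplica (e : G.Inv) : ℕ := (G.req e).elim 0 fun r => r.dot.1

/-- The sequence number of the request of `e`; `0` if there is none. -/
def arNumber (e : G.Inv) : ℕ := (G.req e).elim 0 fun r => r.dot.2

/-- The arbitration order: requests in their final order, followed by the read-only operations in
the order of their invocations. -/
noncomputable def arb : G.Inv → G.Inv → Prop :=
  lexRel G.arClass <| lexRel G.arDelivery <| lexRel G.arStamp <| lexRel G.arReplica <|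
    lexRel G.arNumber fun x y => (x : ℕ) < y

/-- The position of `x` in the trace on which `e` is invoked; read-only operations are placed after
all requests. -/
noncomputable def tracePos (e x : G.Inv) : ℕ :=
  match G.req x with
  | some r => (G.traceAt e).idxOf r
  | none => (G.traceAt e).length + 1

/-- The arbitration order perceived by `e`: the order of the trace on which `e` is invoked, followed
by the read-only operations. -/
noncomputable def perceived (e : G.Inv) : G.Inv → G.Inv → Prop := lexRel (G.tracePos e) G.arb

variable {G}

theorem arb_total : TotalOrderRel G.arb :=
  ((((((totalOrderRel_of_injective Subtype.val_injective).lexRel _).lexRel _).lexRel _).lexRel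
    _).lexRel _)

theorem perceived_total (e : G.Inv) : TotalOrderRel (G.perceived e) := arb_total.lexRel _

theorem arb_iff_reqLt (N : G.NetworkGuarantees) {x y : G.Inv} {r s : Req n Op}
    (hr : G.req x = some r) (hs : G.req y = some s) (hne : x ≠ y) :
    G.arb x y ↔ G.ReqLt r s := by
  have hrs : r ≠ s := fun h => hne (req_injective hr (h ▸ hs))
  have hclass : ∀ {e : G.Inv} {t : Req n Op}, G.req e = some t →
      G.arClass e = if G.TobDelivered t then 0 else 1 := fun h => by simp [arClass, h]
  unfold arb
  rw [lexRel, hclass hr, hclass hs]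
  by_cases h1 : G.TobDelivered r <;> by_cases h2 : G.TobDelivered s
  · have h3 := tobLt_iff_firstDelivery_lt N h1 h2
    have h4 : G.firstDelivery r ≠ G.firstDelivery s := by
      intro h4
      rcases tobLt_or_tobLt N h1 h2 hrs with h5 | h5 <;>
        exact (h5.firstDelivery_lt N).ne (by rw [h4])
    simp [lexRel, arDelivery, hr, hs, h1, h2, h3, h4, ReqLt]
  · simp [h1, h2, ReqLt]
  · have h3 : ¬ G.TobLt r s := fun h => h1 h.delivered_left
    simp [h1, h2, h3, ReqLt]
  · have h3 : ¬ G.TobLt r s := fun h => h1 h.delivered_left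
    have h4 : G.firstDelivery r = G.firstDelivery s := by
      have h0 : ∀ {t : Req n Op}, ¬ G.TobDelivered t → G.firstDelivery t = 0 := by
        intro t ht
        have : {k | ∃ R, G.Occurs k R (Action.tobDeliver t)} = ∅ :=
          Set.eq_empty_of_forall_notMem fun k hk => ht ⟨k, hk⟩
        rw [firstDelivery, this, Nat.sInf_empty]
      rw [h0 h1, h0 h2]
    have h5 : r.dot.1 = s.dot.1 → r.dot.2 ≠ s.dot.2 := fun h6 h7 =>
      hne (Subtype.ext (G.eq_of_dot_eq hr hs (Prod.ext h6 h7)))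
    simp only [h1, h2, h3, h4, if_false, lexRel, arDelivery, arStamp, arReplica, arNumber, hr, hs,
      Option.elim, lt_irrefl, false_or, true_and, ReqLt, not_false_eq_true, false_and, Req.Before,
      Fin.val_fin_lt, Fin.val_inj]
    constructor
    · rintro (h | ⟨h, h' | ⟨h', h'' | ⟨h'', _⟩⟩⟩)
      · exact Or.inl h
      · exact Or.inr ⟨h, Or.inl h'⟩
      · exact Or.inr ⟨h, Or.inr ⟨h', h''⟩⟩
      · exact absurd h'' (h5 h')
    · rintro (h | ⟨h, h' | ⟨h', h''⟩⟩)
      · exact Or.inl h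
      · exact Or.inr ⟨h, Or.inl h'⟩
      · exact Or.inr ⟨h, Or.inr ⟨h', Or.inl h''⟩⟩

theorem arClass_lt {x y : G.Inv} {r : Req n Op} (hx : G.req x = some r) (hy : G.req y = none) :
    G.arClass x < G.arClass y := by
  simp only [arClass, hx, hy]
  split_ifs <;> omega

theorem tracePos_lt {e x y : G.Inv} {r : Req n Op} (hx : G.req x = some r)
    (hy : G.req y = none) : G.tracePos e x < G.tracePos e y := by
  simp only [tracePos, hx, hy]
  have := List.idxOf_le_length (a := r) (l := G.traceAt e)
  omega

end Arbitration

/-! ### The abstract execution -/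

/-- The abstract execution of a run. -/
noncomputable def abstractExecution (N : G.NetworkGuarantees) : AbstractExecution G.history where
  vis := G.Sees
  ar := G.arb
  par := G.perceived
  vis_acyclic := acyclic_of_lt G.effectTime fun _ _ h => h.effectTime_lt N
  vis_natural := by
    intro y
    refine Set.Finite.subset ((Set.finite_Iio (G.effectTime y)).preimage
      Subtype.val_injective.injOn) ?_
    intro x hx
    exact (le_effectTime N x).trans_lt (Sees.effectTime_lt N hx)
  ar_total := arb_total
  par_total := perceived_total

open Filter

theorem finite_of_eventually {p : ℕ → Prop} (h : ∀ᶠ k in atTop, ¬ p k) {P : G.Inv → Prop}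
    (hP : ∀ e, P e → p e) : {e | P e}.Finite := by
  obtain ⟨T, hT⟩ := eventually_atTop.mp h
  refine Set.Finite.subset ((Set.finite_Iio T).preimage Subtype.val_injective.injOn) ?_
  intro e he
  exact lt_of_not_ge fun hge => hT e hge (hP e he)

theorem abstractExecution_EV (A : G.IsAsynchronousRun) :
    (abstractExecution A.network).EV Level.weak := by
  have N := A.network
  change ∀ e : G.Inv,
    {e' : G.Inv | G.lvlOf e' = Level.weak ∧ G.ReturnsBefore e e' ∧ ¬ G.Sees e e'}.Finite
  intro e
  cases hr : G.req e with
  | none =>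
    refine Set.Finite.subset Set.finite_empty ?_
    rintro e' ⟨hl, hrb, hns⟩
    exact hns (Or.inl ⟨hl, Or.inr ⟨hr, lt_of_returnsBefore hrb⟩⟩)
  | some r =>
    by_cases hE : G.Effective r
    · have hev : ∀ᶠ k in atTop, ∀ R, r ∈ (G.config k R).state := by
        refine eventually_all.mpr fun R => ?_
        obtain ⟨q, _, hq⟩ := exists_eventually_prefix_state A hE R
        exact hq.mono fun k hk => hk.subset (by simp)
      refine finite_of_eventually (p := fun k => ¬ ∀ R, r ∈ (G.config k R).state)
        (hev.mono fun k hk => not_not.mpr hk) ?_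
      rintro e' ⟨hl, _, hns⟩ hall
      exact hns ((sees_iff_mem_traceAt hl hr).mpr (hall _))
    · refine Set.Finite.subset Set.finite_empty ?_
      rintro e' ⟨_, hrb, _⟩
      refine hE ⟨⟨e, hr⟩, ?_⟩
      cases hl : G.lvlOf e with
      | weak => exact Or.inl ((lvl_of_req hr).trans hl)
      | strong => exact Or.inr (delivered_of_returnsBefore N hr hl hrb).1

theorem abstractExecution_NCC (N : G.NetworkGuarantees) (l : Level) :
    (abstractExecution N).NCC l := by
  refine acyclic_of_lt G.effectTime ?_
  rintro x y ⟨h, -⟩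
  have hstep : ∀ a b : G.Inv, (G.ReturnsBefore a b ∧ G.history.ss a b) ∨ G.Sees a b →
      G.effectTime a < G.effectTime b := by
    rintro a b (h | h)
    · exact effectTime_lt_of_returnsBefore N h.1
    · exact h.effectTime_lt N
  change Relation.TransGen (fun a b : G.Inv =>
    (G.ReturnsBefore a b ∧ G.history.ss a b) ∨ G.Sees a b) x y at h
  induction h with
  | single h => exact hstep _ _ h
  | tail _ h ih => exact ih.trans (hstep _ _ h)

open Classical in
/-- Once the trace of `e'` starts with the requests up to that of `e` in their final order, `e'`
perceives the rank of `e` correctly. -/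
theorem perceived_iff_arb (N : G.NetworkGuarantees) {e e' x : G.Inv} {r : Req n Op}
    (hr : G.req e = some r) (he' : G.lvlOf e' = Level.weak) {q : List (Req n Op)}
    (hq : ∀ y, y ∈ q ↔ G.Effective y ∧ G.ReqLt y r) (hp : q ++ [r] <+: G.traceAt e')
    (hx : G.Sees x e') : G.perceived e' x e ↔ G.arb x e := by
  cases hs : G.req x with
  | none =>
    have h1 := arClass_lt hr hs
    have h2 := tracePos_lt (e := e') hr hs
    refine iff_of_false ?_ ?_
    · rintro (h | ⟨h, _⟩) <;> omega
    · rintro (h | ⟨h, _⟩) <;> omega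
  | some s =>
    have hmem := (sees_iff_mem_traceAt he' hs).mp hx
    by_cases hxe : x = e
    · subst hxe
      exact iff_of_false ((perceived_total _).1.1 _) (arb_total.1.1 _)
    obtain ⟨t, ht⟩ := hp
    have ht' : G.traceAt e' = q ++ r :: t := by rw [← ht]; simp
    have hrq : r ∉ q := by
      have hnd : (G.traceAt e').Nodup := (consistent N e' _).nodup_state
      rw [ht', List.nodup_append] at hnd
      exact fun h => hnd.2.2 r h r (by simp) rfl
    have hidx := idxOf_lt_iff_mem (t := t) hrq s
    have hne : G.tracePos e' x ≠ G.tracePos e' e := by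
      simp only [tracePos, hs, hr]
      intro h
      obtain rfl := (List.idxOf_inj hmem).mp h
      exact hxe (req_injective hs hr)
    rw [arb_iff_reqLt N hs hr hxe, perceived, lexRel]
    rw [or_iff_left fun h => hne h.1]
    simp only [tracePos, hs, hr]
    rw [ht', hidx, hq]
    exact and_iff_right (effective_of_mem_state N hmem)

theorem abstractExecution_CPar (A : G.IsAsynchronousRun) :
    (abstractExecution A.network).CPar Level.weak := by
  intro e
  have N := A.network
  change {e' : G.Inv | G.lvlOf e' = Level.weak ∧ G.Sees e e' ∧
    rank {x | G.Sees x e'} (G.perceived e') e ≠ rank {x | G.Sees x e'} G.arb e}.Finite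
  have hrank : ∀ e' : G.Inv, (∀ x, G.Sees x e' → (G.perceived e' x e ↔ G.arb x e)) →
      rank {x | G.Sees x e'} (G.perceived e') e = rank {x | G.Sees x e'} G.arb e := by
    intro e' h
    unfold rank
    congr 1
    ext x
    exact and_congr_right fun hx => h x hx
  cases hr : G.req e with
  | none =>
    refine Set.Finite.subset Set.finite_empty ?_
    rintro e' ⟨hl, _, hne⟩
    refine hne (hrank e' fun x _ => ?_)
    cases hs : G.req x with
    | none =>
      have : G.tracePos e' x = G.tracePos e' e := by simp only [tracePos, hr, hs]
      simp [perceived, lexRel, this]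
    | some s => exact iff_of_true (Or.inl (tracePos_lt hs hr)) (Or.inl (arClass_lt hs hr))
  | some r =>
    by_cases hE : G.Effective r
    · choose q hq hev using exists_eventually_prefix_state A hE
      refine finite_of_eventually (p := fun k => ¬ ∀ R, q R ++ [r] <+: (G.config k R).state)
        ((eventually_all.mpr hev).mono fun k hk => not_not.mpr hk) ?_
      rintro e' ⟨hl, _, hne⟩ hall
      exact hne (hrank e' fun x hx => perceived_iff_arb N hr hl (hq _) (hall _) hx)
    · refine Set.Finite.subset Set.finite_empty ?_
      rintro e' ⟨hl, hs, _⟩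
      exact hE (effective_of_mem_state N ((sees_iff_mem_traceAt hl hr).mp hs))

open Classical in
/-- In a trace, a strong request is preceded exactly by the requests delivered before it. -/
theorem idxOf_lt_iff_tobLt (N : G.NetworkGuarantees) {e : G.Inv} {r : Req n Op}
    (hr : r ∈ G.traceAt e) (hl : r.lvl = Level.strong) (x : Req n Op) :
    (G.traceAt e).idxOf x < (G.traceAt e).idxOf r ↔ G.TobLt x r := by
  have hσ : (G.before e).Consistent := consistent N e _
  obtain ⟨h1, h2⟩ := hσ.of_strong r hr hl
  obtain ⟨c, d, hcd⟩ := List.append_of_mem h2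
  obtain ⟨t, ht⟩ := (hσ.prefix_executed h1 hcd).trans hσ.executed_prefix_state
  have ht' : G.traceAt e = c ++ r :: t := by
    rw [traceAt, ← ht]
    simp
  have hrc : r ∉ c := by
    have hnd : (G.traceAt e).Nodup := hσ.nodup_state
    rw [ht', List.nodup_append] at hnd
    exact fun h => hnd.2.2 r h r (by simp) rfl
  rw [ht', ← mem_iff_tobLt N hcd x]
  exact idxOf_lt_iff_mem hrc x

open Classical in
theorem abstractExecution_FRVal (N : G.NetworkGuarantees) :
    (abstractExecution N).FRVal Level.weak S.dataType := by
  change ∀ e : G.Inv, G.lvlOf e = Level.weak →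
    G.response e = some (S.dataType.F (G.opOf e) ((abstractExecution N).fcontext e))
  intro e hl
  rw [response_of_weak hl]
  congr 1
  set C := (abstractExecution N).fcontext e with hC
  have hop : C.IsOperationContext := by
    have ht := perceived_total e
    refine ⟨(abstractExecution N).vis_natural e, acyclic_of_lt (fun x => G.effectTime x.1)
      fun x y h => Sees.effectTime_lt N h, ⟨⟨fun x => ht.1.1 x.1, fun x y z => ht.1.2 x.1 y.1 z.1⟩,
      fun x y hxy => ht.2 x.1 y.1 fun h => hxy (Subtype.ext h)⟩⟩
  let P : {x : G.Inv // G.Sees x e} → Prop := fun x => (G.req x.1).isSome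
  have hP : ∀ x, ¬ P x → S.dataType.ReadOnly (C.op x) := fun x hx =>
    (readOnly_of_req_eq_none (Option.not_isSome_iff_eq_none.mp hx)).2
  rw [S.dataType.F_restrict _ hop P hP]
  symm
  have hσ : (G.before e).Consistent := consistent N e _
  have hmem : ∀ x : {x // P x}, (G.req x.1.1).get x.2 ∈ G.traceAt e := fun x =>
    (sees_iff_mem_traceAt hl (Option.some_get x.2).symm).mp x.1.2
  let g : {x // P x} → Fin (G.traceAt e).length := fun x =>
    ⟨(G.traceAt e).idxOf ((G.req x.1.1).get x.2), List.idxOf_lt_length_of_mem (hmem x)⟩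
  have hget : ∀ x, (G.traceAt e).get (g x) = (G.req x.1.1).get x.2 := fun x =>
    List.getElem_idxOf _
  have hreq : ∀ x : {x // P x}, G.req x.1.1 = some ((G.traceAt e).get (g x)) := fun x => by
    rw [hget]
    exact (Option.some_get x.2).symm
  have hinj : Function.Injective g := by
    intro x y h
    have h1 := hreq x
    rw [h] at h1
    exact Subtype.ext (Subtype.ext (req_injective h1 (hreq y)))
  have hbij : Function.Bijective g := by
    refine ⟨hinj, fun i => ?_⟩
    have hi : (G.traceAt e).get i ∈ G.traceAt e := List.get_mem _ _
    obtain ⟨k, _, hk⟩ := (invariant N e).issued_state _ _ hi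
    obtain ⟨x, _, hx⟩ := exists_req_eq hk
    refine ⟨⟨⟨x, (sees_iff_mem_traceAt hl hx).mpr hi⟩, by simp only [P, hx, Option.isSome_some]⟩, ?_⟩
    apply Fin.ext
    simp only [g, hx, Option.get_some]
    exact List.Nodup.idxOf_getElem hσ.nodup_state _ _
  refine S.dataType.iso_invariant _ _ _ (hop.restrict P)
    ⟨Equiv.ofBijective g hbij, fun x => ?_, fun (x y : {x // P x}) => ?_, fun (x y : {x // P x}) => ?_⟩
  · exact (op_of_req (hreq x)).symm
  · -- Visibility is recorded in the `ctx` field of weak requests, and for strong requests it is the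
    -- order of delivery.
    change G.Sees x.1.1 y.1.1 ↔ (traceContext (G.traceAt e)).vis (g x) (g y)
    unfold traceContext
    simp only
    have hly := lvl_of_req (hreq y)
    split
    · rename_i h
      rw [h] at hly
      rw [sees_iff_mem_traceAt hly.symm (hreq x), dot_mem_ctx_iff N (hreq y) ⟨_, hreq x⟩]
    · rename_i h
      rw [h] at hly
      have h1 := idxOf_lt_iff_tobLt N (e := e) (List.get_mem _ (g y)) h
        ((G.traceAt e).get (g x))
      have h2 : G.Sees x.1.1 y.1.1 ↔ G.TobLt ((G.traceAt e).get (g x))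
          ((G.traceAt e).get (g y)) := by
        simp [Sees, ← hly, hreq x, hreq y]
      rw [h2, ← h1, hget, hget]
      exact Iff.rfl
  · change G.perceived e x.1.1 y.1.1 ↔ g x < g y
    have hpos : ∀ z : {x // P x}, G.tracePos e z.1.1 = g z := by
      intro z
      simp only [tracePos, hreq z]
      rw [hget]
    unfold perceived lexRel
    rw [hpos, hpos, Fin.lt_def]
    refine or_iff_left ?_
    rintro ⟨h, h'⟩
    obtain rfl := hinj (Fin.ext h)
    exact arb_total.1.1 _ h'

theorem satisfiesFEC (A : G.IsAsynchronousRun) :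
    G.history.SatisfiesFEC Level.weak S.dataType :=
  ⟨abstractExecution A.network, abstractExecution_EV A, abstractExecution_NCC A.network _,
    abstractExecution_FRVal A.network, abstractExecution_CPar A⟩

end Execution

/-! ### A run in which total order broadcast delivers nothing -/

/-- A pending strong operation has no return value, whereas linearizability prescribes one. -/
theorem History.not_satisfiesLin_of_pending {H : History Op Val} {l : Level} {e : H.E}
    (hl : H.lvl e = l) (hp : H.rval e = none) (D : DataType Op Val) : ¬ H.SatisfiesLin l D := by
  rintro ⟨A, _, _, _, _, hR⟩
  have := hR e hl
  rw [hp] at this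
  cases this

namespace StrongRun

variable (hn : 0 < n)

/-- The replica performing the event `k`: the replicas take turns. -/
def turn (k : ℕ) : Fin n := ⟨k % n, Nat.mod_lt k hn⟩

theorem infinite_turn (R : Fin n) : {k | turn hn k = R}.Infinite := by
  refine Set.infinite_of_injective_forall_mem (f := fun m => R + n * m) ?_ ?_
  · intro a b h
    exact Nat.eq_of_mul_eq_mul_left hn (Nat.add_left_cancel h)
  · intro m
    exact Fin.ext (by simp [turn, Nat.add_mul_mod_self_left, Nat.mod_eq_of_lt R.2])

variable (S) (op : Op)

/-- The configurations of the run in which the `k`-th event is the strong invocation of `op` by a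
fresh client at local time `k`. -/
noncomputable def config : ℕ → Fin n → RState n Op Val
  | 0 => fun _ => RState.initial n Op Val
  | k + 1 => Function.update (config k) (turn hn k)
      (invokeStep S.dataType (turn hn k) k op Level.strong (config k (turn hn k))).1

/-- The trajectory in which all events are strong invocations of `op` by fresh clients. -/
noncomputable def trajectory : Trajectory n S where
  event k := ⟨turn hn k, k, Action.invoke k op Level.strong⟩
  config := config S hn op
  out k := (invokeStep S.dataType (turn hn k) k op Level.strong (config S hn op k (turn hn k))).2
  config_zero _ := rfl
  config_step k := by simp [step, config]
  config_other k R hR := by simp [config, Function.update_of_ne hR]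

theorem out_eq (k : ℕ) : ((trajectory S hn op).out k).rbcast = none ∧
    ((trajectory S hn op).out k).returned = none ∧
    ((trajectory S hn op).out k).answered = none := by
  change (invokeStep _ _ _ _ _ _).2.rbcast = _ ∧ (invokeStep _ _ _ _ _ _).2.returned = _ ∧
    (invokeStep _ _ _ _ _ _).2.answered = _
  rw [invokeStep_strong]
  exact ⟨rfl, rfl, rfl⟩

theorem respAt_eq_none (k j : ℕ) : (trajectory S hn op).respAt k j = none := by
  unfold Trajectory.respAt
  rw [(out_eq S hn op k).2.1, (out_eq S hn op j).2.2]
  split_ifs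
  · rfl
  · split
    · rename_i h
      cases h
    · rfl
  · rfl

theorem config_idle (k : ℕ) (R : Fin n) :
    (config S hn op k R).toBeRolledBack = [] ∧ (config S hn op k R).toBeExecuted = [] := by
  induction k with
  | zero => exact ⟨rfl, rfl⟩
  | succ k ih =>
    unfold config
    by_cases hR : R = turn hn k
    · subst hR
      rw [Function.update_self, invokeStep_strong]
      exact ih
    · rw [Function.update_of_ne hR]
      exact ih

variable {S op} in
/-- If `op` may be invoked as strong, the trajectory is a well-formed execution. -/
noncomputable def execution (hop : Level.strong ∈ S.lvlmap op) : Execution n S where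
  toTrajectory := trajectory S hn op
  clock_mono j k hjk _ := Int.ofNat_le.mpr hjk.le
  clock_infinite R _ := by
    refine ((infinite_turn hn R).image (f := fun k : ℕ => (k : ℤ))
      Nat.cast_injective.injOn).mono ?_
    rintro _ ⟨k, hk, rfl⟩
    exact ⟨k, hk, rfl⟩
  sticky j k c op' op'' l l' hj hk := by
    obtain ⟨rfl, _, _⟩ := Action.invoke.inj hj
    obtain ⟨rfl, _, _⟩ := Action.invoke.inj hk
    rfl
  sequential j k c op' op'' l l' hjk hj hk := by
    obtain ⟨rfl, _, _⟩ := Action.invoke.inj hj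
    obtain ⟨rfl, _, _⟩ := Action.invoke.inj hk
    exact absurd hjk (lt_irrefl _)
  contract k c op' l h := by
    obtain ⟨_, rfl, rfl⟩ := Action.invoke.inj h
    exact hop

variable {S op}

theorem isAsynchronousRun (hop : Level.strong ∈ S.lvlmap op) :
    (execution hn hop).IsAsynchronousRun := by
  have hrb : ∀ {k R r}, ¬ (execution hn hop).Occurs k R (Action.rbDeliver r) :=
    fun h => nomatch h.2
  have htob : ∀ {k R r}, ¬ (execution hn hop).Occurs k R (Action.tobDeliver r) :=
    fun h => nomatch h.2
  refine ⟨fun R => ⟨infinite_turn hn R, Or.inr ?_, Or.inr ?_⟩, ?_, ?_⟩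
  · refine (infinite_turn hn R).mono fun k hk => ⟨hk, ?_⟩
    rintro ⟨t, ht⟩
    change (step S.dataType R t (config S hn op (k + 1) R) Action.rollback).isSome at ht
    simp [step, rollbackStep, (config_idle S hn op (k + 1) R).1] at ht
  · refine (infinite_turn hn R).mono fun k hk => ⟨hk, ?_⟩
    rintro ⟨t, ht⟩
    change (step S.dataType R t (config S hn op (k + 1) R) Action.execute).isSome at ht
    simp [step, executeStep, (config_idle S hn op (k + 1) R).1,
      (config_idle S hn op (k + 1) R).2] at ht
  · constructor
    · exact fun _ _ _ h => absurd h hrb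
    · exact fun _ _ _ h => absurd h htob
    · exact fun _ _ _ _ h => absurd h hrb
    · exact fun _ _ _ _ h => absurd h htob
    · intro j r h
      have := (out_eq S hn op j).1
      rw [show (trajectory S hn op).out j = (execution hn hop).out j from rfl, h] at this
      cases this
    · rintro r ⟨k, R, h⟩
      exact absurd h htob
    · exact fun _ _ _ _ _ _ _ _ h => absurd h htob
  · intro h
    refine absurd Set.finite_empty (h.mono ?_)
    rintro r ⟨k, R, h⟩
    exact htob h

/-- Every event of the run is the invocation of an operation. -/
def inv (hop : Level.strong ∈ S.lvlmap op) (k : ℕ) : (execution hn hop).Inv := ⟨k, rfl⟩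

theorem lvl_inv (hop : Level.strong ∈ S.lvlmap op) (k : ℕ) :
    (execution hn hop).history.lvl (inv hn hop k) = Level.strong := rfl

theorem rval_inv (hop : Level.strong ∈ S.lvlmap op) (k : ℕ) :
    (execution hn hop).history.rval (inv hn hop k) = none := by
  change (trajectory S hn op).response k = none
  unfold Trajectory.response
  rw [dif_neg]
  rintro ⟨j, hj⟩
  rw [respAt_eq_none] at hj
  cases hj

theorem infinite_inv (hop : Level.strong ∈ S.lvlmap op) (R : Fin n) :
    {e : (execution hn hop).Inv | ((execution hn hop).event e).rep = R}.Infinite := by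
  refine ((infinite_turn hn R).image (f := inv hn hop) fun a _ b _ h =>
    congrArg Subtype.val h).mono ?_
  rintro _ ⟨k, hk, rfl⟩
  exact hk

end StrongRun

end ACT

theorem theorem4 {Op : Type*} {Val : Type*} (n : ℕ) (hn : 0 < n) (S : ACT.Spec Op Val) :
    (∀ G : ACT.Execution n S, G.IsAsynchronousRun →
      G.history.SatisfiesFEC ACT.Level.weak S.dataType) ∧
    ((∃ op, ACT.Level.strong ∈ S.lvlmap op) →
      ∃ G : ACT.Execution n S, G.IsAsynchronousRun ∧
        (∀ R, {e : G.Inv | (G.event e).rep = R}.Infinite) ∧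
        (∃ e, G.history.lvl e = ACT.Level.strong ∧ G.history.rval e = none) ∧
        ¬ G.history.SatisfiesLin ACT.Level.strong S.dataType) := by
  refine ⟨fun G hG => ACT.Execution.satisfiesFEC hG, ?_⟩
  rintro ⟨op, hop⟩
  have hl := ACT.StrongRun.lvl_inv hn hop 0
  have hp := ACT.StrongRun.rval_inv hn hop 0
  exact ⟨ACT.StrongRun.execution hn hop, ACT.StrongRun.isAsynchronousRun hn hop,
    ACT.StrongRun.infinite_inv hn hop, ⟨_, hl, hp⟩,
    ACT.History.not_satisfiesLin_of_pending hl hp _⟩
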